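/- There is an absolute constant $C>0$ such that the following holds. Let $n\ge 1$ and $m\ge 0$ be integers, $\epsilon>0$, and let $P=\sum_{i=1}^m A_iB_i$, where $A_1,\dots,A_m,B_1,\dots,B_m\in\mathbb R[X_1,\dots,X_n]$ are homogeneous of degree $2$ with $0\preceq A_i\preceq\|X\|^2$ and $B_i\succeq 0$ for every $i$, and $\sum_i B_i\preceq\|X\|^2$. (Here $\|X\|^2=X_1^2+\dots+X_n^2$, and $F\preceq G$ means that $G-F$ is a sum of squares of polynomials.) Put $\|P\|=\max\{|P(x)| : x\in\mathbb R^n,\ \|x\|=1\}$. A degree-$d$ pseudo-expectation is a linear functional $\tilde{\mathbb E}$ on the real polynomials in $X_1,\dots,X_n$ of degree at most $d$ with $\tilde{\mathbb E}\,1=1$ and $\tilde{\mathbb E}\,Q^2\ge 0$ for every polynomial $Q$ of degree at most $d/2$. The value of the degree-$d$ sum-of-squares relaxation is the supremum of $\tilde{\mathbb E}P$ over all degree-$d$ pseudo-expectations that are consistent with the constraint $\|X\|^2=1$, i.e. that satisfy $\tilde{\mathbb E}\,(\|X\|^2-1)^2=0$. Then, for every integer $d\ge 4$ with $d\ge C\log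 n/\epsilon^2$: 1. the value of the degree-$d$ sum-of-squares relaxation is at most $3\|P\|+\epsilon$; 2. if moreover no variable occurs both in one of $A_1,\dots,A_m$ and in one of $B_1,\dots,B_m$, the value of the degree-$d$ sum-of-squares relaxation is at most $\|P\|+\epsilon$. -/

import Mathlib

open MvPolynomial

noncomputable section

/-- The real polynomials in `n` variables of total degree at most `d`. -/
abbrev PolyLE (n d : ℕ) : Submodule ℝ (MvPolynomial (Fin n) ℝ) :=
  restrictTotalDegree (Fin n) ℝ d

/-- The square of a polynomial of degree at most `d / 2`, as a polynomial of degree at most `d`. -/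
def PolyLE.sq {n d : ℕ} (q : MvPolynomial (Fin n) ℝ) (hq : 2 * q.totalDegree ≤ d) :
    PolyLE n d :=
  ⟨q ^ 2, (mem_restrictTotalDegree (Fin n) d (q ^ 2)).2 ((totalDegree_pow q 2).trans hq)⟩

/-- A degree-`d` pseudo-expectation functional in `n` variables: a linear functional on the
polynomials of degree at most `d` that maps `1` to `1` and the square of every polynomial of degree
at most `d / 2` to a nonnegative number. -/
structure PseudoExpectation (n d : ℕ) where
  /-- the underlying linear functional -/
  E : PolyLE n d →ₗ[ℝ] ℝ
  map_one : E ⟨1, (mem_restrictTotalDegree (Fin n) d 1).2 (by simp)⟩ = 1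
  map_sq_nonneg : ∀ (q : MvPolynomial (Fin n) ℝ) (hq : 2 * q.totalDegree ≤ d),
    0 ≤ E (PolyLE.sq q hq)

/-- A degree-`d` pseudo-expectation is consistent with the constraint `q = 0`, where `q` has degree
at most `d / 2`, if it maps `q ^ 2` to `0`. -/
def PseudoExpectation.IsConsistent {n d : ℕ} (μ : PseudoExpectation n d)
    (q : MvPolynomial (Fin n) ℝ) : Prop :=
  ∃ hq : 2 * q.totalDegree ≤ d, μ.E (PolyLE.sq q hq) = 0

/-- The polynomial `‖X‖ ^ 2 = X₁ ^ 2 + ⋯ + Xₙ ^ 2`. -/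
def normSqPoly (n : ℕ) : MvPolynomial (Fin n) ℝ := ∑ i, X i ^ 2

/-- The value of the degree-`d` sum-of-squares relaxation for maximizing `P` over the unit sphere:
the supremum of the pseudo-expectation of `P` over all degree-`d` pseudo-expectations that are
consistent with `‖X‖ ^ 2 = 1`. It is taken in the extended reals. -/
def sosValue {n : ℕ} (d : ℕ) (P : MvPolynomial (Fin n) ℝ) (hP : P.totalDegree ≤ d) : EReal :=
  ⨆ (μ : PseudoExpectation n d) (_ : μ.IsConsistent (normSqPoly n - 1)),
    ((μ.E ⟨P, (mem_restrictTotalDegree (Fin n) d P).2 hP⟩ : ℝ) : EReal)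

/-- The norm `‖P‖ = max {|P(x)| : ‖x‖ = 1}` of a polynomial. -/
def polyNorm {n : ℕ} (P : MvPolynomial (Fin n) ℝ) : ℝ :=
  sSup {r : ℝ | ∃ x : EuclideanSpace ℝ (Fin n), ‖x‖ = 1 ∧ r = |eval (fun i => x i) P|}

/-- The relation `P ⪯ Q` on polynomials: `Q - P` is a sum of squares of polynomials. -/
def SOSLE {n : ℕ} (P Q : MvPolynomial (Fin n) ℝ) : Prop := IsSumSq (Q - P)

/-- `P = A₁ B₁ + ⋯ + Aₘ Bₘ` for quadratic forms `0 ⪯ Aᵢ ⪯ ‖X‖ ^ 2` and `0 ⪯ Bᵢ` with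
`B₁ + ⋯ + Bₘ ⪯ ‖X‖ ^ 2`. -/
structure IsOneWayLOCC {n m : ℕ} (P : MvPolynomial (Fin n) ℝ)
    (A B : Fin m → MvPolynomial (Fin n) ℝ) : Prop where
  eq_sum : P = ∑ i, A i * B i
  homogeneous_A : ∀ i, (A i).IsHomogeneous 2
  homogeneous_B : ∀ i, (B i).IsHomogeneous 2
  nonneg_A : ∀ i, SOSLE 0 (A i)
  A_le : ∀ i, SOSLE (A i) (normSqPoly n)
  nonneg_B : ∀ i, SOSLE 0 (B i)
  sum_B_le : SOSLE (∑ i, B i) (normSqPoly n)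

theorem IsOneWayLOCC.totalDegree_le {n m : ℕ} {P : MvPolynomial (Fin n) ℝ}
    {A B : Fin m → MvPolynomial (Fin n) ℝ} (h : IsOneWayLOCC P A B) : P.totalDegree ≤ 4 := by
  rw [h.eq_sum]
  exact (IsHomogeneous.sum _ _ 4 fun i _ =>
    (h.homogeneous_A i).mul (h.homogeneous_B i)).totalDegree_le

end

/-!
Write the quadratic forms as matrices and add an outcome with `A = 0`, so that `0 ⪯ Aᵢ ⪯ 1`,
`0 ⪯ Bᵢ` and `∑ Bᵢ = 1`. The forms `Bᵢ` then act as a measurement: reweighing a pseudo-expectation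
by `Bᵢ` happens with probability `pᵢ`, the pseudo-expectation of `Bᵢ`, and averaging over the
outcomes gives the original pseudo-expectation back, because `∑ Bᵢ` is `‖X‖ ^ 2`.

Let `ρ` be the matrix of second moments, which has trace `1`, and let `Ā = ∑ pᵢ Aᵢ`. The
pseudo-expectation of `P = ∑ Aᵢ Bᵢ` is the value `∑ tr (Aᵢ ρ) tr (Bᵢ ρ)` of a product state plus
the pseudo-expectation of `∑ (Aᵢ - Ā) Bᵢ` (`IsSpherical.map_mul_sum_le_of_mean`).

*Product states.* Diagonalizing `ρ` reduces their value to pairs of orthonormal vectors `u`, `v`.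
The values of `P` at `u ± v` and the inequality `tr (A B) ≥ 0` for the positive semidefinite
restrictions of `A = Aᵢ` and `B = Bᵢ` to the span of `u` and `v` give the bound `3 ‖P‖`
(`sum_trace_mul_trace_le`). If the `Aᵢ` and the `Bᵢ` use different coordinates, a vector that
combines the two groups of coordinates with the right weights gives `‖P‖` (`sum_trace_mul_trace_le_of_disjoint`).

*Error terms.* Condition on `k` outcomes one after the other. The error terms add up to the
expectation of the form of `S`, the sum of the differences `Aᵢ - Ā` along the path, in the final
conditioned state, and this is at most the expected largest eigenvalue of `S`. Now `S` is a matrix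
martingale with increments of norm at most `1`, so its largest eigenvalue is of order
`√(k log n)`: the potential `tr S ^ (2 q) + n T ^ (2 q)` grows at each step by a factor at most
`exp (4 q² / T²)` (`Matrix.sum_trace_add_pow_le`), since along a segment its second derivative is
controlled by the potential itself (`Matrix.trace_pow_mul_mul_pow_mul_le`). Taking `q` about `log n`
and `T² = 4 q k` and dividing by `k` leaves an error of order `√(log n / k)`, and `k` may be about
`d / 4`. The induction on the number of rounds, `IsSpherical.nsmul_map_mul_add_le`, carries the
weight `w` (the product of the outcomes so far) and `S` along, so that paths of outcomes never have
to be written down.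
-/

/-! ### Traces of powers of symmetric matrices -/

theorem Matrix.IsHermitian.exists_orthogonal_diagonal {ι : Type*} [Fintype ι] [DecidableEq ι]
    {M : Matrix ι ι ℝ} (hM : M.IsHermitian) :
    ∃ (U : Matrix ι ι ℝ) (l : ι → ℝ), U.transpose * U = 1 ∧ U * U.transpose = 1 ∧
      M = U * Matrix.diagonal l * U.transpose := by
  refine ⟨hM.eigenvectorUnitary, hM.eigenvalues, ?_, ?_, ?_⟩
  · have := Unitary.coe_star_mul_self hM.eigenvectorUnitary
    rwa [Matrix.star_eq_conjTranspose, Matrix.conjTranspose_eq_transpose_of_trivial] at this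
  · have := Unitary.coe_mul_star_self hM.eigenvectorUnitary
    rwa [Unitary.coe_star, Matrix.star_eq_conjTranspose,
      Matrix.conjTranspose_eq_transpose_of_trivial] at this
  · have := hM.spectral_theorem
    rw [Unitary.conjStarAlgAut_apply, Matrix.star_eq_conjTranspose,
      Matrix.conjTranspose_eq_transpose_of_trivial] at this
    simpa [Function.comp_def] using this

section

variable {ι : Type*} [Fintype ι] [DecidableEq ι]

theorem Matrix.conj_orthogonal_pow {U : Matrix ι ι ℝ} (hU : U.transpose * U = 1)
    (hU' : U * U.transpose = 1) (l : ι → ℝ) (k : ℕ) :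
    (U * Matrix.diagonal l * U.transpose) ^ k = U * Matrix.diagonal (l ^ k) * U.transpose := by
  induction k with
  | zero => simp [hU']
  | succ k ih =>
    rw [pow_succ, ih]
    calc _ = U * Matrix.diagonal (l ^ k) * (U.transpose * U) * Matrix.diagonal l * U.transpose := by
          simp only [Matrix.mul_assoc]
      _ = _ := by
          rw [hU, Matrix.mul_one, Matrix.mul_assoc U, Matrix.diagonal_mul_diagonal, pow_succ]
          rfl

theorem Matrix.trace_conj_orthogonal {U : Matrix ι ι ℝ} (hU : U.transpose * U = 1)
    (l : ι → ℝ) : (U * Matrix.diagonal l * U.transpose).trace = ∑ i, l i := by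
  rw [Matrix.trace_mul_comm, ← Matrix.mul_assoc, hU, Matrix.one_mul, Matrix.trace_diagonal]

theorem pow_mul_pow_le_add_pow (x y : ℝ) {a b r : ℕ} (h : a + b = 2 * r) :
    x ^ a * y ^ b ≤ x ^ (2 * r) + y ^ (2 * r) := by
  have key : ∀ x y : ℝ, |x| ≤ |y| → ∀ a b : ℕ, a + b = 2 * r → |x| ^ a * |y| ^ b ≤ y ^ (2 * r) := by
    intro x y hxy a b hab
    calc |x| ^ a * |y| ^ b ≤ |y| ^ a * |y| ^ b := by gcongr
      _ = y ^ (2 * r) := by rw [← pow_add, hab, pow_mul, sq_abs, ← pow_mul]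
  have hx : 0 ≤ x ^ (2 * r) := by rw [pow_mul]; positivity
  have hy : 0 ≤ y ^ (2 * r) := by rw [pow_mul]; positivity
  have h1 : x ^ a * y ^ b ≤ |x| ^ a * |y| ^ b := by
    rw [← abs_pow, ← abs_pow, ← abs_mul]; exact le_abs_self _
  rcases le_total |x| |y| with hxy | hxy
  · linarith [key x y hxy a b h]
  · have := key y x hxy b a (by omega)
    linarith [mul_comm (|x| ^ a) (|y| ^ b)]

theorem Matrix.trace_pow_nonneg {M : Matrix ι ι ℝ} (hM : M.IsHermitian) (r : ℕ) :
    0 ≤ (M ^ (2 * r)).trace := by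
  obtain ⟨U, l, h1, h2, rfl⟩ := hM.exists_orthogonal_diagonal
  rw [Matrix.conj_orthogonal_pow h1 h2, Matrix.trace_conj_orthogonal h1]
  refine Finset.sum_nonneg fun i _ => ?_
  rw [Pi.pow_apply, pow_mul]; positivity

/-- In an eigenbasis of `M`, the trace is `∑ᵢⱼ λᵢᵃ λⱼᵇ Dᵢⱼ²`, and every row of `D` has norm at
most `1`. -/
theorem Matrix.trace_pow_mul_mul_pow_mul_le {M D : Matrix ι ι ℝ} (hM : M.IsHermitian)
    (hD : D.IsHermitian) (hD1 : (1 - D * D).PosSemidef) {a b r : ℕ} (h : a + b = 2 * r) :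
    (M ^ a * D * M ^ b * D).trace ≤ 2 * (M ^ (2 * r)).trace := by
  obtain ⟨U, l, h1, h2, rfl⟩ := hM.exists_orthogonal_diagonal
  simp only [Matrix.conj_orthogonal_pow h1 h2, Matrix.trace_conj_orthogonal h1]
  set E := U.transpose * D * U with hE
  have hEs : ∀ i j, E i j = E j i := by
    have : E.transpose = E := by
      rw [hE, Matrix.transpose_mul, Matrix.transpose_mul, Matrix.transpose_transpose,
        ← Matrix.conjTranspose_eq_transpose_of_trivial D, hD.eq, Matrix.mul_assoc]
    intro i j
    conv_lhs => rw [← this]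
    rfl
  have hrow : ∀ i, ∑ j, E i j ^ 2 ≤ 1 := by
    intro i
    have h3 := (hD1.conjTranspose_mul_mul_same U).diag_nonneg (i := i)
    have h4 : U.conjTranspose * (1 - D * D) * U = 1 - E * E := by
      rw [Matrix.conjTranspose_eq_transpose_of_trivial, hE, Matrix.mul_sub, Matrix.sub_mul,
        Matrix.mul_one, h1]
      congr 1
      calc U.transpose * (D * D) * U = U.transpose * D * 1 * D * U := by
            simp only [Matrix.mul_assoc, Matrix.one_mul]
        _ = _ := by rw [← h2]; simp only [Matrix.mul_assoc]
    rw [h4, Matrix.sub_apply, Matrix.one_apply_eq, Matrix.mul_apply] at h3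
    have : ∑ j, E i j ^ 2 = ∑ j, E i j * E j i := by
      refine Finset.sum_congr rfl fun j _ => ?_
      rw [hEs j i, sq]
    linarith
  have h5 : (U * Matrix.diagonal (l ^ a) * U.transpose * D *
      (U * Matrix.diagonal (l ^ b) * U.transpose) * D).trace
      = ∑ i, ∑ j, l i ^ a * l j ^ b * E i j ^ 2 := by
    have : U * Matrix.diagonal (l ^ a) * U.transpose * D *
      (U * Matrix.diagonal (l ^ b) * U.transpose) * D =
      U * (Matrix.diagonal (l ^ a) * E * Matrix.diagonal (l ^ b) * (U.transpose * D)) := by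
      simp only [hE, Matrix.mul_assoc]
    rw [this, Matrix.trace_mul_comm, Matrix.mul_assoc, ← hE]
    simp only [Matrix.trace, Matrix.diag_apply]
    refine Finset.sum_congr rfl fun i _ => ?_
    rw [Matrix.mul_apply]
    refine Finset.sum_congr rfl fun j _ => ?_
    rw [Matrix.mul_diagonal, Matrix.diagonal_mul, hEs j i, Pi.pow_apply, Pi.pow_apply]
    ring
  rw [h5]
  have hl : ∀ i, 0 ≤ l i ^ (2 * r) := fun i => by rw [pow_mul]; positivity
  calc ∑ i, ∑ j, l i ^ a * l j ^ b * E i j ^ 2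
      ≤ ∑ i, ∑ j, (l i ^ (2 * r) + l j ^ (2 * r)) * E i j ^ 2 := by
        gcongr with i _ j _
        exact pow_mul_pow_le_add_pow _ _ h
    _ = ∑ i, ∑ j, l i ^ (2 * r) * E i j ^ 2 + ∑ i, ∑ j, l j ^ (2 * r) * E i j ^ 2 := by
        simp only [add_mul, Finset.sum_add_distrib]
    _ = ∑ i, l i ^ (2 * r) * ∑ j, E i j ^ 2 + ∑ i, l i ^ (2 * r) * ∑ j, E i j ^ 2 := by
        congr 1
        · simp only [Finset.mul_sum]
        · rw [Finset.sum_comm]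
          simp only [Finset.mul_sum]
          refine Finset.sum_congr rfl fun i _ => Finset.sum_congr rfl fun j _ => ?_
          rw [hEs j i]
    _ ≤ ∑ i, l i ^ (2 * r) * 1 + ∑ i, l i ^ (2 * r) * 1 := by
        gcongr with i _ i _
        · exact hl i
        · exact hrow i
        · exact hl i
        · exact hrow i
    _ = 2 * ∑ i, (l ^ (2 * r)) i := by simp [two_mul]

theorem Matrix.sq_mul_trace_pow_le {M : Matrix ι ι ℝ} (hM : M.IsHermitian) (T : ℝ) (r : ℕ) :
    T ^ 2 * (M ^ (2 * r)).trace ≤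
      (M ^ (2 * (r + 1))).trace + Fintype.card ι * T ^ (2 * (r + 1)) := by
  obtain ⟨U, l, h1, h2, rfl⟩ := hM.exists_orthogonal_diagonal
  simp only [Matrix.conj_orthogonal_pow h1 h2, Matrix.trace_conj_orthogonal h1]
  have : (Fintype.card ι : ℝ) * T ^ (2 * (r + 1)) = ∑ _i : ι, T ^ (2 * (r + 1)) := by simp
  rw [this, ← Finset.sum_add_distrib, Finset.mul_sum]
  refine Finset.sum_le_sum fun i _ => ?_
  have := pow_mul_pow_le_add_pow T (l i) (a := 2) (b := 2 * r) (r := r + 1) (by ring)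
  simp only [Pi.pow_apply]
  linarith

/-- The largest eigenvalue of `M` is at most `T (1 + tr (M / T) ^ (2 r))`. -/
theorem Matrix.posSemidef_smul_one_sub {M : Matrix ι ι ℝ} (hM : M.IsHermitian) {T : ℝ}
    (hT : 0 < T) {r : ℕ} (hr : 1 ≤ r) :
    ((T + T * ((M ^ (2 * r)).trace / T ^ (2 * r))) • (1 : Matrix ι ι ℝ) - M).PosSemidef := by
  obtain ⟨U, l, h1, h2, rfl⟩ := hM.exists_orthogonal_diagonal
  simp only [Matrix.conj_orthogonal_pow h1 h2, Matrix.trace_conj_orthogonal h1]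
  set τ := T + T * ((∑ i, (l ^ (2 * r)) i) / T ^ (2 * r)) with hτ
  have hl : ∀ i, l i ≤ τ := by
    intro i
    have h3 : (l i) ^ (2 * r) ≤ ∑ i, (l ^ (2 * r)) i :=
      Finset.single_le_sum (f := l ^ (2 * r)) (fun j _ => by
        rw [Pi.pow_apply, pow_mul]; positivity) (Finset.mem_univ i)
    have h4 : T + T * ((l i) ^ (2 * r) / T ^ (2 * r)) ≤ τ := by rw [hτ]; gcongr
    refine le_trans ?_ h4
    rw [← div_pow]
    have h5 : 0 ≤ (l i / T) ^ (2 * r) := by rw [pow_mul]; positivity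
    rcases le_total (l i) T with h | h
    · nlinarith
    · have h6 : 1 ≤ l i / T := (one_le_div hT).2 h
      have h7 : l i / T ≤ (l i / T) ^ (2 * r) := le_self_pow₀ h6 (by omega)
      have h8 : l i = T * (l i / T) := by field_simp
      nlinarith
  have h3 : τ • (1 : Matrix ι ι ℝ) - U * Matrix.diagonal l * U.transpose =
      U * Matrix.diagonal (fun i => τ - l i) * U.conjTranspose := by
    have : Matrix.diagonal (fun i => τ - l i) = τ • (1 : Matrix ι ι ℝ) - Matrix.diagonal l := by
      ext i j; by_cases h : i = j <;> simp [h]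
    rw [this, Matrix.conjTranspose_eq_transpose_of_trivial, Matrix.mul_sub, Matrix.sub_mul]
    simp [h2]
  rw [h3]
  exact (Matrix.PosSemidef.diagonal fun i => sub_nonneg.2 (hl i)).mul_mul_conjTranspose_same U

/-- Comparison with the solution `f 0 * cosh (ω t)` of `f'' = ω² f`. -/
theorem le_mul_cosh_of_deriv_deriv_le {f f' f'' : ℝ → ℝ} {ω : ℝ}
    (hf : ∀ t, HasDerivAt f (f' t) t) (hf' : ∀ t, HasDerivAt f' (f'' t) t)
    (hle : ∀ t, f'' t ≤ ω ^ 2 * f t) (h0 : f' 0 = 0) :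
    f 1 ≤ Real.cosh ω * f 0 := by
  have hc : ∀ t, HasDerivAt (fun t => Real.cosh (ω * t)) (Real.sinh (ω * t) * ω) t := fun t => by
    simpa using ((hasDerivAt_id t).const_mul ω).cosh
  have hs : ∀ t, HasDerivAt (fun t => Real.sinh (ω * t)) (Real.cosh (ω * t) * ω) t := fun t => by
    simpa using ((hasDerivAt_id t).const_mul ω).sinh
  -- the Wronskian of `f` and `cosh (ω t)` decreases from `0`
  let G : ℝ → ℝ := fun t => f' t * Real.cosh (ω * t) - f t * (Real.sinh (ω * t) * ω)
  have hG : ∀ t, HasDerivAt G ((f'' t - ω ^ 2 * f t) * Real.cosh (ω * t)) t := fun t => by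
    refine (((hf' t).mul (hc t)).sub ((hf t).mul ((hs t).mul_const ω))).congr_deriv ?_
    ring
  have hGanti : Antitone G := antitone_of_hasDerivAt_nonpos hG fun t =>
    mul_nonpos_of_nonpos_of_nonneg (by linarith [hle t]) (Real.cosh_pos _).le
  have hG0 : ∀ t, 0 ≤ t → G t ≤ 0 := fun t ht => by
    have := hGanti ht
    simpa [G, h0] using this
  have hq : ∀ t, HasDerivAt (fun t => f t / Real.cosh (ω * t))
      (G t / Real.cosh (ω * t) ^ 2) t := fun t =>
    (hf t).div (hc t) (Real.cosh_pos _).ne'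
  have hanti : AntitoneOn (fun t => f t / Real.cosh (ω * t)) (Set.Icc 0 1) := by
    refine antitoneOn_of_deriv_nonpos (convex_Icc 0 1)
      (fun t _ => (hq t).continuousAt.continuousWithinAt)
      (fun t _ => (hq t).differentiableAt.differentiableWithinAt) fun t ht => ?_
    rw [interior_Icc] at ht
    rw [(hq t).deriv]
    exact div_nonpos_of_nonpos_of_nonneg (hG0 t ht.1.le) (sq_nonneg _)
  have := hanti (Set.left_mem_Icc.2 zero_le_one) (Set.right_mem_Icc.2 zero_le_one) zero_le_one
  simp only [mul_one, mul_zero, Real.cosh_zero, div_one] at this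
  rwa [div_le_iff₀ (Real.cosh_pos _), mul_comm] at this

section Deriv

attribute [local instance] Matrix.linftyOpNormedRing Matrix.linftyOpNormedAlgebra

theorem Matrix.hasDerivAt_add_smul_pow (S D : Matrix ι ι ℝ) (p : ℕ) (t : ℝ) :
    HasDerivAt (fun t : ℝ => (S + t • D) ^ p)
      (∑ a ∈ Finset.range p, (S + t • D) ^ (p.pred - a) * D * (S + t • D) ^ a) t := by
  have h : HasDerivAt (fun t : ℝ => S + t • D) D t := by
    exact (((hasDerivAt_id t).smul_const D).const_add S).congr_deriv (one_smul ℝ D)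
  exact h.fun_pow' p

theorem Matrix.hasDerivAt_trace_mul (N : Matrix ι ι ℝ) {f : ℝ → Matrix ι ι ℝ} {f' : Matrix ι ι ℝ}
    {t : ℝ} (hf : HasDerivAt f f' t) : HasDerivAt (fun t => (f t * N).trace) (f' * N).trace t := by
  let T : Matrix ι ι ℝ →L[ℝ] ℝ :=
    LinearMap.toContinuousLinearMap ((Matrix.traceLinearMap ι ℝ ℝ) ∘ₗ LinearMap.mulRight ℝ N)
  exact T.hasFDerivAt.comp_hasDerivAt t hf

theorem Matrix.hasDerivAt_trace_pow (S D : Matrix ι ι ℝ) (p : ℕ) (t : ℝ) :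
    HasDerivAt (fun t : ℝ => ((S + t • D) ^ (p + 1)).trace)
      ((p + 1) * ((S + t • D) ^ p * D).trace) t := by
  have h := Matrix.hasDerivAt_trace_mul 1 (Matrix.hasDerivAt_add_smul_pow S D (p + 1) t)
  simp only [Matrix.mul_one] at h
  convert h using 1
  rw [Matrix.trace_sum, Finset.sum_congr rfl (g := fun _ => ((S + t • D) ^ p * D).trace)]
  · simp
  · intro a ha
    rw [Matrix.trace_mul_comm, ← Matrix.mul_assoc, ← pow_add]
    congr 3
    have := Finset.mem_range.1 ha
    simp only [Nat.pred_eq_sub_one]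
    omega

theorem Matrix.hasDerivAt_trace_pow_mul (S D : Matrix ι ι ℝ) (p : ℕ) (t : ℝ) :
    HasDerivAt (fun t : ℝ => ((S + t • D) ^ p * D).trace)
      (∑ a ∈ Finset.range p, ((S + t • D) ^ (p.pred - a) * D * (S + t • D) ^ a * D).trace) t := by
  have h := Matrix.hasDerivAt_trace_mul D (Matrix.hasDerivAt_add_smul_pow S D p t)
  rwa [Finset.sum_mul, Matrix.trace_sum] at h

end Deriv

/-- One step of a matrix martingale with increments of norm at most `1` multiplies the moment
potential `tr S ^ (2 q) + n T ^ (2 q)` by at most `exp (4 q² / T²)`. -/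
theorem Matrix.sum_trace_add_pow_le {κ : Type*} [Fintype κ] {p : κ → ℝ} (hp : ∀ i, 0 ≤ p i)
    (hp1 : ∑ i, p i = 1) {D : κ → Matrix ι ι ℝ} (hD : ∀ i, (D i).IsHermitian)
    (hD1 : ∀ i, (1 - D i * D i).PosSemidef) (hD0 : ∑ i, p i • D i = 0)
    {S : Matrix ι ι ℝ} (hS : S.IsHermitian) {q : ℕ} (hq : 1 ≤ q) {T : ℝ} (hT : 0 < T) :
    ∑ i, p i * (((S + D i) ^ (2 * q)).trace + Fintype.card ι * T ^ (2 * q)) ≤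
      Real.exp (4 * q ^ 2 / T ^ 2) *
        ((S ^ (2 * q)).trace + Fintype.card ι * T ^ (2 * q)) := by
  obtain ⟨r, rfl⟩ : ∃ r, q = r + 1 := ⟨q - 1, by omega⟩
  let ω : ℝ := Real.sqrt (8 * ((r + 1 : ℕ) : ℝ) ^ 2 / T ^ 2)
  have hω : ω ^ 2 = 8 * ((r + 1 : ℕ) : ℝ) ^ 2 / T ^ 2 := Real.sq_sqrt (by positivity)
  let f : ℝ → ℝ := fun t => ∑ i, p i *
    (((S + t • D i) ^ (2 * r + 1 + 1)).trace + Fintype.card ι * T ^ (2 * (r + 1)))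
  let f' : ℝ → ℝ := fun t => ∑ i, p i *
    (((2 * r + 1 : ℕ) + 1) * ((S + t • D i) ^ (2 * r + 1) * D i).trace)
  let f'' : ℝ → ℝ := fun t => ∑ i, p i * (((2 * r + 1 : ℕ) + 1) *
    ∑ a ∈ Finset.range (2 * r + 1),
      ((S + t • D i) ^ ((2 * r + 1).pred - a) * D i * (S + t • D i) ^ a * D i).trace)
  have hf : ∀ t, HasDerivAt f (f' t) t := fun t =>
    HasDerivAt.fun_sum fun i _ =>
      ((Matrix.hasDerivAt_trace_pow S (D i) (2 * r + 1) t).add_const _).const_mul (p i)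
  have hf' : ∀ t, HasDerivAt f' (f'' t) t := fun t =>
    HasDerivAt.fun_sum fun i _ =>
      ((Matrix.hasDerivAt_trace_pow_mul S (D i) (2 * r + 1) t).const_mul _).const_mul (p i)
  have hle : ∀ t, f'' t ≤ ω ^ 2 * f t := by
    intro t
    simp only [f, f'']
    rw [Finset.mul_sum]
    refine Finset.sum_le_sum fun i _ => ?_
    rw [mul_left_comm (ω ^ 2)]
    refine mul_le_mul_of_nonneg_left ?_ (hp i)
    have hM : (S + t • D i).IsHermitian := by
      refine hS.add ?_
      rw [Matrix.IsHermitian, Matrix.conjTranspose_smul, (hD i).eq]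
      simp
    have h1 : ∑ a ∈ Finset.range (2 * r + 1),
      ((S + t • D i) ^ ((2 * r + 1).pred - a) * D i * (S + t • D i) ^ a * D i).trace ≤
        ∑ a ∈ Finset.range (2 * r + 1), 2 * ((S + t • D i) ^ (2 * r)).trace := by
      refine Finset.sum_le_sum fun a ha => ?_
      refine Matrix.trace_pow_mul_mul_pow_mul_le hM (hD i) (hD1 i) ?_
      have := Finset.mem_range.1 ha
      simp only [Nat.pred_eq_sub_one]
      omega
    rw [Finset.sum_const, Finset.card_range, nsmul_eq_mul] at h1
    have h2 := Matrix.sq_mul_trace_pow_le hM T r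
    have h3 := Matrix.trace_pow_nonneg hM r
    rw [hω, div_mul_eq_mul_div, le_div_iff₀ (by positivity)]
    have e : 2 * r + 1 + 1 = 2 * (r + 1) := by ring
    rw [e]
    set X := ((S + t • D i) ^ (2 * r)).trace
    set Y := ((S + t • D i) ^ (2 * (r + 1))).trace + Fintype.card ι * T ^ (2 * (r + 1))
    push_cast at h1 ⊢
    calc _ ≤ ((2 * r + 1 + 1) * ((2 * r + 1) * (2 * X))) * T ^ 2 := by gcongr
      _ = (2 * r + 2) * (2 * r + 1) * 2 * (T ^ 2 * X) := by ring
      _ ≤ (2 * r + 2) * (2 * r + 2) * 2 * (T ^ 2 * X) := by gcongr; norm_num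
      _ ≤ (2 * r + 2) * (2 * r + 2) * 2 * Y := by gcongr
      _ = _ := by ring
  have h0 : f' 0 = 0 := by
    have : f' 0 = ((2 * r + 1 : ℕ) + 1) * (S ^ (2 * r + 1) * ∑ i, p i • D i).trace := by
      simp only [f', zero_smul, add_zero, Finset.mul_sum, Matrix.trace_sum,
        Matrix.mul_smul, Matrix.trace_smul, smul_eq_mul]
      refine Finset.sum_congr rfl fun i _ => ?_
      ring
    rw [this, hD0]; simp
  have key := le_mul_cosh_of_deriv_deriv_le hf hf' hle h0
  have hf0 : f 0 = (S ^ (2 * (r + 1))).trace + Fintype.card ι * T ^ (2 * (r + 1)) := by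
    simp only [f, zero_smul, add_zero, ← Finset.sum_mul, hp1, one_mul]
    rfl
  have hf1 : f 1 = ∑ i, p i * (((S + D i) ^ (2 * (r + 1))).trace +
      Fintype.card ι * T ^ (2 * (r + 1))) := by
    simp only [f, one_smul]
    rfl
  rw [← hf0, ← hf1]
  refine key.trans ?_
  have hnn : 0 ≤ f 0 := by
    rw [hf0]
    have := Matrix.trace_pow_nonneg hS (r + 1)
    positivity
  refine mul_le_mul_of_nonneg_right ((Real.cosh_le_exp_half_sq ω).trans_eq ?_) hnn
  rw [hω]; congr 1; ring

end

section

variable {n : ℕ}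

/-! ### Quadratic forms and sums of squares -/

/-- The quadratic form `∑ F a b X_a X_b` of a matrix `F`, as a polynomial. -/
noncomputable def quadPoly (n : ℕ) :
    Matrix (Fin n) (Fin n) ℝ →ₗ[ℝ] MvPolynomial (Fin n) ℝ where
  toFun F := ∑ a, ∑ b, F a b • (X a * X b)
  map_add' F G := by simp only [Matrix.add_apply, add_smul, Finset.sum_add_distrib]
  map_smul' c F := by
    simp only [Matrix.smul_apply, smul_eq_mul, mul_smul, Finset.smul_sum, RingHom.id_apply]


theorem quadPoly_apply (F : Matrix (Fin n) (Fin n) ℝ) :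
    quadPoly n F = ∑ a, ∑ b, F a b • (X a * X b) := rfl

theorem quadPoly_one : quadPoly n 1 = normSqPoly n := by
  rw [quadPoly_apply, normSqPoly]
  refine Finset.sum_congr rfl fun a _ => ?_
  rw [Finset.sum_eq_single a]
  · simp [sq]
  · intro b _ hb; simp [Matrix.one_apply_ne hb.symm]
  · simp

theorem eval_quadPoly (F : Matrix (Fin n) (Fin n) ℝ) (x : Fin n → ℝ) :
    eval x (quadPoly n F) = x ⬝ᵥ F.mulVec x := by
  simp only [quadPoly_apply, map_sum, smul_eval, map_mul, eval_X, dotProduct, Matrix.mulVec,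
    Finset.mul_sum]
  refine Finset.sum_congr rfl fun a _ => Finset.sum_congr rfl fun b _ => ?_
  ring

theorem quadPoly_transpose (F : Matrix (Fin n) (Fin n) ℝ) :
    quadPoly n F.transpose = quadPoly n F := by
  rw [quadPoly_apply, quadPoly_apply, Finset.sum_comm]
  refine Finset.sum_congr rfl fun a _ => Finset.sum_congr rfl fun b _ => ?_
  rw [Matrix.transpose_apply, mul_comm]

theorem totalDegree_quadPoly_le (F : Matrix (Fin n) (Fin n) ℝ) :
    (quadPoly n F).totalDegree ≤ 2 := by
  rw [quadPoly_apply]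
  refine totalDegree_finsetSum_le fun a _ => totalDegree_finsetSum_le fun b _ => ?_
  refine (totalDegree_smul_le _ _).trans ((totalDegree_mul _ _).trans ?_)
  simp

theorem MvPolynomial.IsHomogeneous.exists_quadPoly_eq {f : MvPolynomial (Fin n) ℝ}
    (hf : f.IsHomogeneous 2) : ∃ F : Matrix (Fin n) (Fin n) ℝ, F.IsHermitian ∧ quadPoly n F = f := by
  have h : f ∈ LinearMap.range (quadPoly n) := by
    rw [f.as_sum]
    refine Submodule.sum_mem _ fun m hm => ?_
    have hdeg : m.degree = 2 := by
      rw [Finsupp.degree_eq_weight_one]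
      exact hf (mem_support_iff.1 hm)
    have hcard : m.toMultiset.card = 2 := by
      rw [Finsupp.card_toMultiset, ← hdeg]
      rfl
    obtain ⟨a, b, hab⟩ := Multiset.card_eq_two.1 hcard
    have hmab : m = Finsupp.single a 1 + Finsupp.single b 1 := by
      rw [Finsupp.toMultiset_eq_iff.1 hab, ← Multiset.toFinsupp_singleton,
        ← Multiset.toFinsupp_singleton, ← map_add]
      rfl
    refine ⟨Matrix.single a b (coeff m f), ?_⟩
    rw [quadPoly_apply, Finset.sum_eq_single a, Finset.sum_eq_single b]
    · rw [Matrix.single_apply_same]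
      conv_rhs => rw [← mul_one (coeff m f), ← smul_eq_mul, ← smul_monomial]
      congr 1
      rw [hmab, X, X, monomial_mul, mul_one]
    · intro c _ hc; simp [Matrix.single, hc.symm]
    · simp
    · intro c _ hc; simp [Matrix.single, hc.symm]
    · simp
  obtain ⟨F, rfl⟩ := h
  refine ⟨(1 / 2 : ℝ) • (F + F.transpose), ?_, ?_⟩
  · rw [Matrix.IsHermitian, Matrix.conjTranspose_eq_transpose_of_trivial, Matrix.transpose_smul,
      Matrix.transpose_add, Matrix.transpose_transpose, add_comm]
  · rw [map_smul, map_add, quadPoly_transpose, ← two_smul ℝ, smul_smul]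
    norm_num

theorem IsSumSq.eval_nonneg {f : MvPolynomial (Fin n) ℝ} (hf : IsSumSq f) (x : Fin n → ℝ) :
    0 ≤ eval x f := by
  induction hf with
  | zero => simp
  | sq_add a _ ih => rw [map_add, map_mul]; exact add_nonneg (mul_self_nonneg _) ih

theorem Matrix.posSemidef_of_eval_quadPoly_nonneg {F : Matrix (Fin n) (Fin n) ℝ}
    (hF : F.IsHermitian) (h : ∀ x, 0 ≤ eval x (quadPoly n F)) : F.PosSemidef := by
  refine Matrix.PosSemidef.of_dotProduct_mulVec_nonneg hF fun x => ?_
  simpa [eval_quadPoly] using h x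

/-- The cone of sums of squares of polynomials of degree at most `k`. -/
noncomputable def sosCone (n k : ℕ) : AddSubmonoid (MvPolynomial (Fin n) ℝ) :=
  AddSubmonoid.closure {f | ∃ q, totalDegree q ≤ k ∧ f = q ^ 2}

theorem sq_mem_sosCone {q : MvPolynomial (Fin n) ℝ} {k : ℕ} (h : totalDegree q ≤ k) :
    q ^ 2 ∈ sosCone n k := AddSubmonoid.subset_closure ⟨q, h, rfl⟩

theorem one_mem_sosCone (k : ℕ) : (1 : MvPolynomial (Fin n) ℝ) ∈ sosCone n k := by
  have := sq_mem_sosCone (n := n) (q := 1) (k := k) (by simp)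
  rwa [one_pow] at this

theorem totalDegree_le_of_mem_sosCone {f : MvPolynomial (Fin n) ℝ} {k : ℕ}
    (h : f ∈ sosCone n k) : f.totalDegree ≤ 2 * k := by
  induction h using AddSubmonoid.closure_induction with
  | mem f hf =>
    obtain ⟨q, hq, rfl⟩ := hf
    exact (totalDegree_pow q 2).trans (by omega)
  | zero => simp
  | add f g _ _ hf hg => exact (totalDegree_add f g).trans (max_le hf hg)

theorem mul_mem_sosCone {f g : MvPolynomial (Fin n) ℝ} {k l : ℕ} (hf : f ∈ sosCone n k)
    (hg : g ∈ sosCone n l) : f * g ∈ sosCone n (k + l) := by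
  induction hf using AddSubmonoid.closure_induction with
  | mem f hf =>
    obtain ⟨q, hq, rfl⟩ := hf
    induction hg using AddSubmonoid.closure_induction with
    | mem g hg =>
      obtain ⟨r, hr, rfl⟩ := hg
      rw [← mul_pow]
      exact sq_mem_sosCone ((totalDegree_mul q r).trans (add_le_add hq hr))
    | zero => rw [mul_zero]; exact zero_mem _
    | add g g' _ _ h h' => rw [mul_add]; exact add_mem h h'
  | zero => rw [zero_mul]; exact zero_mem _
  | add f f' _ _ h h' => rw [add_mul]; exact add_mem h h'

theorem Matrix.PosSemidef.quadPoly_mem_sosCone {F : Matrix (Fin n) (Fin n) ℝ}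
    (hF : F.PosSemidef) : quadPoly n F ∈ sosCone n 1 := by
  obtain ⟨m, v, rfl⟩ := Matrix.posSemidef_iff_eq_sum_vecMulVec.mp hF
  rw [map_sum]
  refine sum_mem fun i _ => ?_
  have : quadPoly n (Matrix.vecMulVec (v i) (star (v i))) = (∑ a, v i a • X a) ^ 2 := by
    rw [quadPoly_apply, sq, Finset.sum_mul_sum]
    refine Finset.sum_congr rfl fun a _ => Finset.sum_congr rfl fun b _ => ?_
    rw [Matrix.vecMulVec_apply, smul_mul_smul_comm]
    rfl
  rw [this]
  refine sq_mem_sosCone (totalDegree_finsetSum_le fun a _ => ?_)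
  exact (totalDegree_smul_le _ _).trans (by simp)

/-! ### Pseudo-expectations as functionals on all polynomials -/

/-- A linear functional on all polynomials that is nonnegative on the squares of polynomials of
degree at most `d / 2` and that does not see a factor `‖X‖ ^ 2` in degrees at most `d / 2`. Beyond
degree `d` its values carry no information. -/
structure IsSpherical (d : ℕ) (L : MvPolynomial (Fin n) ℝ →ₗ[ℝ] ℝ) : Prop where
  map_one : L 1 = 1
  sq_nonneg : ∀ q, 2 * q.totalDegree ≤ d → 0 ≤ L (q ^ 2)
  mul_normSq : ∀ q, 2 * q.totalDegree ≤ d → L (q * normSqPoly n) = L q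

theorem IsSpherical.nonneg {d k : ℕ} {L : MvPolynomial (Fin n) ℝ →ₗ[ℝ] ℝ} (hL : IsSpherical d L)
    (hk : 2 * k ≤ d) {f : MvPolynomial (Fin n) ℝ} (hf : f ∈ sosCone n k) : 0 ≤ L f := by
  induction hf using AddSubmonoid.closure_induction with
  | mem f hf =>
    obtain ⟨q, hq, rfl⟩ := hf
    exact hL.sq_nonneg q (by omega)
  | zero => simp
  | add f g _ _ hf hg => rw [map_add]; exact add_nonneg hf hg

/-- The multiples `q (‖X‖ ^ 2 - 1)` are annihilated by the Cauchy-Schwarz inequality. -/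
theorem PseudoExpectation.IsConsistent.exists_isSpherical {d : ℕ} {μ : PseudoExpectation n d}
    (h : μ.IsConsistent (normSqPoly n - 1)) :
    ∃ L : MvPolynomial (Fin n) ℝ →ₗ[ℝ] ℝ, IsSpherical d L ∧ ∀ p : PolyLE n d, L p = μ.E p := by
  obtain ⟨L, hL⟩ := LinearMap.exists_extend μ.E
  have hLE : ∀ p : PolyLE n d, L p = μ.E p := fun p => by rw [← hL]; rfl
  have hsq : ∀ q, 2 * q.totalDegree ≤ d → 0 ≤ L (q ^ 2) := fun q hq => by
    have := μ.map_sq_nonneg q hq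
    rwa [← hLE] at this
  refine ⟨L, ⟨?_, hsq, fun q hq => ?_⟩, hLE⟩
  · rw [← μ.map_one, ← hLE]
  · obtain ⟨hg, h0⟩ := h
    rw [← hLE] at h0
    change L ((normSqPoly n - 1) ^ 2) = 0 at h0
    set g := normSqPoly n - 1 with hgdef
    have key : ∀ s : ℝ, 0 ≤ 2 * s * L (q * g) + s ^ 2 * L (q ^ 2) := by
      intro s
      have h1 := hsq (g + s • q) (by
        have h2 := totalDegree_add g (s • q)
        have h3 := totalDegree_smul_le s q
        have h4 : max g.totalDegree (s • q).totalDegree ≤ d / 2 := max_le (by omega) (by omega)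
        omega)
      have h2 : (g + s • q) ^ 2 = g ^ 2 + (2 * s) • (q * g) + s ^ 2 • q ^ 2 := by
        simp only [smul_eq_C_mul, C_mul, C_pow, map_ofNat]
        ring
      rw [h2, map_add, map_add, map_smul, map_smul, h0, smul_eq_mul, smul_eq_mul] at h1
      linarith
    have hz : L (q * g) = 0 := by
      by_contra hne
      have h2 : 0 ≤ L (q ^ 2) := hsq q hq
      -- the quadratic polynomial in `s` is negative at this point
      have := key (-(L (q * g)) / (L (q ^ 2) + 1))
      have h3 : 2 * (-(L (q * g)) / (L (q ^ 2) + 1)) * L (q * g) +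
          (-(L (q * g)) / (L (q ^ 2) + 1)) ^ 2 * L (q ^ 2) =
          -(L (q * g) ^ 2 * (L (q ^ 2) + 2)) / (L (q ^ 2) + 1) ^ 2 := by
        field_simp
        ring
      rw [h3] at this
      have h4 : 0 < L (q * g) ^ 2 * (L (q ^ 2) + 2) / (L (q ^ 2) + 1) ^ 2 := by positivity
      rw [neg_div] at this
      linarith
    have h5 : q * normSqPoly n = q * g + q := by rw [hgdef]; ring
    rw [h5, map_add, hz, zero_add]

/-! ### Product states -/

section

variable {ι κ : Type*} [Fintype ι] [Fintype κ]

theorem Matrix.IsHermitian.dotProduct_mulVec_comm {A : Matrix ι ι ℝ} (hA : A.IsHermitian)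
    (u v : ι → ℝ) : u ⬝ᵥ A.mulVec v = v ⬝ᵥ A.mulVec u := by
  rw [Matrix.dotProduct_mulVec, ← Matrix.mulVec_transpose,
    ← Matrix.conjTranspose_eq_transpose_of_trivial, hA.eq, dotProduct_comm]

theorem Matrix.IsHermitian.dotProduct_mulVec_add_smul {A : Matrix ι ι ℝ} (hA : A.IsHermitian)
    (u v : ι → ℝ) (t : ℝ) : (u + t • v) ⬝ᵥ A.mulVec (u + t • v) =
      u ⬝ᵥ A.mulVec u + 2 * t * (u ⬝ᵥ A.mulVec v) + t ^ 2 * (v ⬝ᵥ A.mulVec v) := by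
  simp only [Matrix.mulVec_add, Matrix.mulVec_smul, dotProduct_add, add_dotProduct,
    smul_dotProduct, dotProduct_smul, smul_eq_mul, hA.dotProduct_mulVec_comm v u]
  ring

theorem Matrix.PosSemidef.dotProduct_mulVec_self_nonneg {A : Matrix ι ι ℝ} (hA : A.PosSemidef)
    (u : ι → ℝ) : 0 ≤ u ⬝ᵥ A.mulVec u := by simpa using hA.dotProduct_mulVec_nonneg u

theorem Matrix.PosSemidef.sq_dotProduct_mulVec_le {A : Matrix ι ι ℝ} (hA : A.PosSemidef)
    (u v : ι → ℝ) :
    (u ⬝ᵥ A.mulVec v) ^ 2 ≤ (u ⬝ᵥ A.mulVec u) * (v ⬝ᵥ A.mulVec v) := by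
  have h : ∀ t : ℝ, 0 ≤ (v ⬝ᵥ A.mulVec v) * (t * t) + 2 * (u ⬝ᵥ A.mulVec v) * t +
      u ⬝ᵥ A.mulVec u := fun t => by
    have := hA.dotProduct_mulVec_self_nonneg (u + t • v)
    rw [hA.isHermitian.dotProduct_mulVec_add_smul] at this
    linarith
  have := discrim_le_zero h
  rw [discrim] at this
  linarith

/-- The trace of the product of the positive semidefinite restrictions of `A` and `B` to the span
of `u` and `v` is nonnegative. -/
theorem Matrix.PosSemidef.restrict_mul_restrict_nonneg {A B : Matrix ι ι ℝ} (hA : A.PosSemidef)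
    (hB : B.PosSemidef) (u v : ι → ℝ) :
    0 ≤ (u ⬝ᵥ A.mulVec u) * (u ⬝ᵥ B.mulVec u) + (v ⬝ᵥ A.mulVec v) * (v ⬝ᵥ B.mulVec v) +
      2 * ((u ⬝ᵥ A.mulVec v) * (u ⬝ᵥ B.mulVec v)) := by
  have h1 := hA.sq_dotProduct_mulVec_le u v
  have h2 := hB.sq_dotProduct_mulVec_le u v
  have h3 := hA.dotProduct_mulVec_self_nonneg u
  have h4 := hA.dotProduct_mulVec_self_nonneg v
  have h5 := hB.dotProduct_mulVec_self_nonneg u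
  have h6 := hB.dotProduct_mulVec_self_nonneg v
  set a := u ⬝ᵥ A.mulVec v
  set b := u ⬝ᵥ B.mulVec v
  set a₁ := u ⬝ᵥ A.mulVec u
  set a₂ := v ⬝ᵥ A.mulVec v
  set b₁ := u ⬝ᵥ B.mulVec u
  set b₂ := v ⬝ᵥ B.mulVec v
  have h7 : (2 * (a * b)) ^ 2 ≤ (a₁ * b₁ + a₂ * b₂) ^ 2 := by
    have : a ^ 2 * b ^ 2 ≤ (a₁ * a₂) * (b₁ * b₂) := by gcongr
    nlinarith [sq_nonneg (a₁ * b₁ - a₂ * b₂)]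
  have := (abs_le_of_sq_le_sq' h7 (by positivity)).1
  linarith

/-- On the span of an orthonormal pair, adding the values of `P` at the orthogonal vectors `u + v`
and `u - v` controls the mixed values. -/
theorem sum_mul_add_sum_mul_le_of_orthonormal {A B : κ → Matrix ι ι ℝ}
    (hA : ∀ i, (A i).PosSemidef) (hB : ∀ i, (B i).PosSemidef) {N : ℝ}
    (hN : ∀ x : ι → ℝ, ∑ i, (x ⬝ᵥ (A i).mulVec x) * (x ⬝ᵥ (B i).mulVec x) ≤ N * (x ⬝ᵥ x) ^ 2)
    {u v : ι → ℝ} (hu : u ⬝ᵥ u = 1) (hv : v ⬝ᵥ v = 1) (huv : u ⬝ᵥ v = 0) :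
    ∑ i, (u ⬝ᵥ (A i).mulVec u) * (v ⬝ᵥ (B i).mulVec v) +
      ∑ i, (v ⬝ᵥ (A i).mulVec v) * (u ⬝ᵥ (B i).mulVec u) ≤ 6 * N := by
  have h1 := hN (u + (1 : ℝ) • v)
  have h2 := hN (u + (-1 : ℝ) • v)
  have h3 := hN u
  have h4 := hN v
  have hvu : v ⬝ᵥ u = 0 := by rw [dotProduct_comm, huv]
  have e1 : (u + (1 : ℝ) • v) ⬝ᵥ (u + (1 : ℝ) • v) = 2 := by
    simp [hu, hv, huv, hvu]; norm_num
  have e2 : (u + (-1 : ℝ) • v) ⬝ᵥ (u + (-1 : ℝ) • v) = 2 := by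
    simp [hu, hv, huv, hvu]; norm_num
  have h5 : 0 ≤ ∑ i, ((u ⬝ᵥ (A i).mulVec u) * (u ⬝ᵥ (B i).mulVec u) +
      (v ⬝ᵥ (A i).mulVec v) * (v ⬝ᵥ (B i).mulVec v) +
      2 * ((u ⬝ᵥ (A i).mulVec v) * (u ⬝ᵥ (B i).mulVec v))) :=
    Finset.sum_nonneg fun i _ => (hA i).restrict_mul_restrict_nonneg (hB i) u v
  have h6 : ∑ i, ((u + (1 : ℝ) • v) ⬝ᵥ (A i).mulVec (u + (1 : ℝ) • v)) *
        ((u + (1 : ℝ) • v) ⬝ᵥ (B i).mulVec (u + (1 : ℝ) • v)) +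
      ∑ i, ((u + (-1 : ℝ) • v) ⬝ᵥ (A i).mulVec (u + (-1 : ℝ) • v)) *
        ((u + (-1 : ℝ) • v) ⬝ᵥ (B i).mulVec (u + (-1 : ℝ) • v)) =
      2 * (∑ i, (u ⬝ᵥ (A i).mulVec u) * (v ⬝ᵥ (B i).mulVec v) +
        ∑ i, (v ⬝ᵥ (A i).mulVec v) * (u ⬝ᵥ (B i).mulVec u)) -
      2 * (∑ i, (u ⬝ᵥ (A i).mulVec u) * (u ⬝ᵥ (B i).mulVec u) +
        ∑ i, (v ⬝ᵥ (A i).mulVec v) * (v ⬝ᵥ (B i).mulVec v)) +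
      4 * ∑ i, ((u ⬝ᵥ (A i).mulVec u) * (u ⬝ᵥ (B i).mulVec u) +
        (v ⬝ᵥ (A i).mulVec v) * (v ⬝ᵥ (B i).mulVec v) +
        2 * ((u ⬝ᵥ (A i).mulVec v) * (u ⬝ᵥ (B i).mulVec v))) := by
    simp only [← Finset.sum_add_distrib, Finset.mul_sum, ← Finset.sum_sub_distrib]
    refine Finset.sum_congr rfl fun i _ => ?_
    rw [(hA i).isHermitian.dotProduct_mulVec_add_smul,
      (hB i).isHermitian.dotProduct_mulVec_add_smul,
      (hA i).isHermitian.dotProduct_mulVec_add_smul,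
      (hB i).isHermitian.dotProduct_mulVec_add_smul]
    ring
  rw [e1] at h1
  rw [e2] at h2
  rw [hu] at h3
  rw [hv] at h4
  linarith

theorem sum_sum_mul_mul_sum (l : ι → ℝ) (a b : κ → ι → ℝ) :
    ∑ i, (∑ k, l k * a i k) * (∑ j, l j * b i j) =
      ∑ k, ∑ j, l k * l j * ∑ i, a i k * b i j := by
  simp only [Finset.sum_mul_sum]
  simp only [Finset.mul_sum]
  rw [Finset.sum_comm]
  refine Finset.sum_congr rfl fun k _ => ?_
  rw [Finset.sum_comm]
  refine Finset.sum_congr rfl fun j _ => Finset.sum_congr rfl fun i _ => ?_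
  ring

variable [DecidableEq ι]

theorem Matrix.trace_mul_conj_diagonal (A U : Matrix ι ι ℝ) (l : ι → ℝ) :
    (A * (U * Matrix.diagonal l * U.transpose)).trace =
      ∑ k, l k * (U.col k ⬝ᵥ A.mulVec (U.col k)) := by
  rw [← Matrix.mul_assoc, Matrix.trace_mul_comm, ← Matrix.mul_assoc, ← Matrix.mul_assoc]
  simp only [Matrix.trace, Matrix.diag_apply]
  refine Finset.sum_congr rfl fun k _ => ?_
  rw [Matrix.mul_diagonal, mul_comm, Matrix.mul_assoc, Matrix.mul_apply]
  rfl

/-- The eigendecomposition of a density matrix `ρ` as a convex combination of orthonormal pure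
states. -/
theorem Matrix.PosSemidef.exists_trace_mul_eq_sum {ρ : Matrix ι ι ℝ} (hρ : ρ.PosSemidef)
    (htr : ρ.trace = 1) : ∃ (l : ι → ℝ) (u : ι → ι → ℝ), (∀ k, 0 ≤ l k) ∧ ∑ k, l k = 1 ∧
      (∀ k, u k ⬝ᵥ u k = 1) ∧ (∀ k j, k ≠ j → u k ⬝ᵥ u j = 0) ∧
      ∀ A : Matrix ι ι ℝ, (A * ρ).trace = ∑ k, l k * (u k ⬝ᵥ A.mulVec (u k)) := by
  obtain ⟨U, l, h1, h2, rfl⟩ := hρ.isHermitian.exists_orthogonal_diagonal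
  have hU : ∀ k j, U.col k ⬝ᵥ U.col j = (1 : Matrix ι ι ℝ) k j := fun k j => by
    rw [← h1]; rfl
  refine ⟨l, fun k => U.col k, fun k => ?_, ?_, fun k => ?_, fun k j hkj => ?_,
    fun A => Matrix.trace_mul_conj_diagonal A U l⟩
  · have h3 := (hρ.conjTranspose_mul_mul_same U).diag_nonneg (i := k)
    have h4 : U.conjTranspose * (U * Matrix.diagonal l * U.transpose) * U = Matrix.diagonal l := by
      rw [Matrix.conjTranspose_eq_transpose_of_trivial]
      calc _ = (U.transpose * U) * Matrix.diagonal l * (U.transpose * U) := by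
            simp only [Matrix.mul_assoc]
        _ = _ := by rw [h1, Matrix.one_mul, Matrix.mul_one]
    rwa [h4, Matrix.diagonal_apply_eq] at h3
  · rwa [Matrix.trace_conj_orthogonal h1] at htr
  · rw [hU, Matrix.one_apply_eq]
  · rw [hU, Matrix.one_apply_ne hkj]

theorem sum_trace_mul_trace_le {A B : κ → Matrix ι ι ℝ}
    (hA : ∀ i, (A i).PosSemidef) (hB : ∀ i, (B i).PosSemidef) {N : ℝ} (hN0 : 0 ≤ N)
    (hN : ∀ x : ι → ℝ, ∑ i, (x ⬝ᵥ (A i).mulVec x) * (x ⬝ᵥ (B i).mulVec x) ≤ N * (x ⬝ᵥ x) ^ 2)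
    {ρ : Matrix ι ι ℝ} (hρ : ρ.PosSemidef) (htr : ρ.trace = 1) :
    ∑ i, (A i * ρ).trace * (B i * ρ).trace ≤ 3 * N := by
  obtain ⟨l, u, hl, hl1, hu1, hu0, htrace⟩ := hρ.exists_trace_mul_eq_sum htr
  simp only [htrace]
  rw [sum_sum_mul_mul_sum l (fun i k => u k ⬝ᵥ (A i).mulVec (u k))
    (fun i k => u k ⬝ᵥ (B i).mulVec (u k))]
  let Q : ι → ι → ℝ := fun k j => ∑ i, (u k ⬝ᵥ (A i).mulVec (u k)) * (u j ⬝ᵥ (B i).mulVec (u j))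
  have hQ : ∀ k j, Q k j + Q j k ≤ 6 * N := fun k j => by
    by_cases hkj : k = j
    · subst hkj
      have : Q k k ≤ N * (u k ⬝ᵥ u k) ^ 2 := hN (u k)
      rw [hu1] at this
      linarith
    · exact sum_mul_add_sum_mul_le_of_orthonormal hA hB hN (hu1 k) (hu1 j) (hu0 k j hkj)
  change ∑ k, ∑ j, l k * l j * Q k j ≤ 3 * N
  have hsymm : ∑ k, ∑ j, l k * l j * Q k j = ∑ k, ∑ j, l k * l j * Q j k := by
    rw [Finset.sum_comm]
    refine Finset.sum_congr rfl fun k _ => Finset.sum_congr rfl fun j _ => ?_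
    ring
  have hsum : ∑ k, ∑ j, l k * l j * (Q k j + Q j k) ≤ ∑ k, ∑ j, l k * l j * (6 * N) := by
    gcongr with k _ j _
    · exact mul_nonneg (hl k) (hl j)
    · exact hQ k j
  have e1 : ∑ k, ∑ j, l k * l j * (6 * N) = 6 * N := by
    simp only [← Finset.sum_mul, ← Finset.mul_sum, hl1, mul_one, one_mul]
  have e2 : ∑ k, ∑ j, l k * l j * (Q k j + Q j k) =
      ∑ k, ∑ j, l k * l j * Q k j + ∑ k, ∑ j, l k * l j * Q j k := by
    simp only [mul_add, Finset.sum_add_distrib]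
  linarith

/-- When the forms `A i` and `B i` live on complementary coordinates, the vector equal to `s u` on
the first ones and to `t v` on the others has value `s² t² ∑ A i (u) B i (v)`. The weights
`s² = ‖v‖²`, `t² = ‖u‖²` (restricted norms) give the bound. -/
theorem sum_mul_le_of_disjoint {A B : κ → Matrix ι ι ℝ} {N : ℝ}
    (hN : ∀ x : ι → ℝ, ∑ i, (x ⬝ᵥ (A i).mulVec x) * (x ⬝ᵥ (B i).mulVec x) ≤ N * (x ⬝ᵥ x) ^ 2)
    (V : Finset ι)
    (hAV : ∀ i x y, (∀ a ∈ V, x a = y a) → x ⬝ᵥ (A i).mulVec x = y ⬝ᵥ (A i).mulVec y)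
    (hBV : ∀ i x y, (∀ a ∉ V, x a = y a) → x ⬝ᵥ (B i).mulVec x = y ⬝ᵥ (B i).mulVec y)
    (u v : ι → ℝ) :
    ∑ i, (u ⬝ᵥ (A i).mulVec u) * (v ⬝ᵥ (B i).mulVec v) ≤
      4 * N * ((∑ a ∈ V, u a ^ 2) * ∑ a ∈ Vᶜ, v a ^ 2) := by
  set α := ∑ a ∈ V, u a ^ 2 with hα
  set β := ∑ a ∈ Vᶜ, v a ^ 2 with hβ
  have hα0 : 0 ≤ α := Finset.sum_nonneg fun _ _ => sq_nonneg _
  have hβ0 : 0 ≤ β := Finset.sum_nonneg fun _ _ => sq_nonneg _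
  rcases hα0.eq_or_lt with h | hαpos
  · have hz : ∀ a ∈ V, u a = 0 := fun a ha => by
      have := (Finset.sum_eq_zero_iff_of_nonneg (fun _ _ => sq_nonneg _)).1 h.symm a ha
      exact pow_eq_zero_iff (two_ne_zero) |>.1 this
    have : ∀ i, u ⬝ᵥ (A i).mulVec u = 0 := fun i => by
      rw [hAV i u 0 hz]; simp
    simp [this, ← h]
  rcases hβ0.eq_or_lt with h | hβpos
  · have hz : ∀ a ∉ V, v a = 0 := fun a ha => by
      have := (Finset.sum_eq_zero_iff_of_nonneg (fun _ _ => sq_nonneg _)).1 h.symm a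
        (Finset.mem_compl.2 ha)
      exact pow_eq_zero_iff (two_ne_zero) |>.1 this
    have : ∀ i, v ⬝ᵥ (B i).mulVec v = 0 := fun i => by
      rw [hBV i v 0 hz]; simp
    simp [this, ← h]
  let z : ι → ℝ := fun a => if a ∈ V then Real.sqrt β * u a else Real.sqrt α * v a
  have hsmul : ∀ (M : Matrix ι ι ℝ) (c : ℝ) (x : ι → ℝ),
      (c • x) ⬝ᵥ M.mulVec (c • x) = c ^ 2 * (x ⬝ᵥ M.mulVec x) := fun M c x => by
    simp only [Matrix.mulVec_smul, smul_dotProduct, dotProduct_smul, smul_eq_mul]; ring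
  have hzA : ∀ i, z ⬝ᵥ (A i).mulVec z = β * (u ⬝ᵥ (A i).mulVec u) := fun i => by
    rw [hAV i z (Real.sqrt β • u) (fun a ha => by simp [z, ha]), hsmul, Real.sq_sqrt hβ0]
  have hzB : ∀ i, z ⬝ᵥ (B i).mulVec z = α * (v ⬝ᵥ (B i).mulVec v) := fun i => by
    rw [hBV i z (Real.sqrt α • v) (fun a ha => by simp [z, ha]), hsmul, Real.sq_sqrt hα0]
  have hzz : z ⬝ᵥ z = 2 * (α * β) := by
    have h1 : z ⬝ᵥ z = ∑ a ∈ V, z a ^ 2 + ∑ a ∈ Vᶜ, z a ^ 2 := by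
      rw [Finset.sum_add_sum_compl]
      exact Finset.sum_congr rfl fun a _ => (sq _).symm
    have h2 : ∑ a ∈ V, z a ^ 2 = β * α := by
      rw [hα, Finset.mul_sum]
      refine Finset.sum_congr rfl fun a ha => ?_
      simp only [z, if_pos ha]
      rw [mul_pow, Real.sq_sqrt hβ0]
    have h3 : ∑ a ∈ Vᶜ, z a ^ 2 = α * β := by
      conv_rhs => rw [hβ, Finset.mul_sum]
      refine Finset.sum_congr rfl fun a ha => ?_
      simp only [z, if_neg (Finset.mem_compl.1 ha)]
      rw [mul_pow, Real.sq_sqrt hα0]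
    rw [h1, h2, h3]; ring
  have key := hN z
  simp only [hzA, hzB, hzz] at key
  have e : ∑ i, β * (u ⬝ᵥ (A i).mulVec u) * (α * (v ⬝ᵥ (B i).mulVec v)) =
      (α * β) * ∑ i, (u ⬝ᵥ (A i).mulVec u) * (v ⬝ᵥ (B i).mulVec v) := by
    rw [Finset.mul_sum]
    exact Finset.sum_congr rfl fun i _ => by ring
  rw [e] at key
  have hpos : 0 < α * β := mul_pos hαpos hβpos
  refine le_of_mul_le_mul_left ?_ hpos
  linarith

theorem sum_trace_mul_trace_le_of_disjoint {A B : κ → Matrix ι ι ℝ} {N : ℝ} (hN0 : 0 ≤ N)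
    (hN : ∀ x : ι → ℝ, ∑ i, (x ⬝ᵥ (A i).mulVec x) * (x ⬝ᵥ (B i).mulVec x) ≤ N * (x ⬝ᵥ x) ^ 2)
    (V : Finset ι)
    (hAV : ∀ i x y, (∀ a ∈ V, x a = y a) → x ⬝ᵥ (A i).mulVec x = y ⬝ᵥ (A i).mulVec y)
    (hBV : ∀ i x y, (∀ a ∉ V, x a = y a) → x ⬝ᵥ (B i).mulVec x = y ⬝ᵥ (B i).mulVec y)
    {ρ : Matrix ι ι ℝ} (hρ : ρ.PosSemidef) (htr : ρ.trace = 1) :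
    ∑ i, (A i * ρ).trace * (B i * ρ).trace ≤ N := by
  obtain ⟨l, u, hl, hl1, hu1, -, htrace⟩ := hρ.exists_trace_mul_eq_sum htr
  simp only [htrace]
  rw [sum_sum_mul_mul_sum l (fun i k => u k ⬝ᵥ (A i).mulVec (u k))
    (fun i k => u k ⬝ᵥ (B i).mulVec (u k))]
  let α : ι → ℝ := fun k => ∑ a ∈ V, u k a ^ 2
  have hβ : ∀ k, ∑ a ∈ Vᶜ, u k a ^ 2 = 1 - α k := fun k => by
    rw [← hu1 k, eq_sub_iff_add_eq', Finset.sum_add_sum_compl]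
    exact Finset.sum_congr rfl fun a _ => sq _
  calc ∑ k, ∑ j, l k * l j * ∑ i, (u k ⬝ᵥ (A i).mulVec (u k)) * (u j ⬝ᵥ (B i).mulVec (u j))
      ≤ ∑ k, ∑ j, l k * l j * (4 * N * (α k * (1 - α j))) := by
        gcongr with k _ j _
        · exact mul_nonneg (hl k) (hl j)
        · rw [← hβ]
          exact sum_mul_le_of_disjoint hN V hAV hBV (u k) (u j)
    _ = 4 * N * ((∑ k, l k * α k) * ∑ j, l j * (1 - α j)) := by
        rw [Finset.sum_mul_sum, Finset.mul_sum]
        refine Finset.sum_congr rfl fun k _ => ?_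
        rw [Finset.mul_sum]
        exact Finset.sum_congr rfl fun j _ => by ring
    _ = 4 * N * ((∑ k, l k * α k) * (1 - ∑ k, l k * α k)) := by
        simp only [mul_sub, Finset.sum_sub_distrib, mul_one, hl1]
    _ ≤ N := by
        nlinarith [mul_nonneg hN0 (sq_nonneg (2 * (∑ k, l k * α k) - 1))]

end

/-! ### The martingale of conditioned states -/

/-- The matrix of the moments `L (w X_a X_b)`: the (unnormalized) second moments after reweighing
the pseudo-expectation `L` by `w`. -/
noncomputable def momentMatrix (L : MvPolynomial (Fin n) ℝ →ₗ[ℝ] ℝ)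
    (w : MvPolynomial (Fin n) ℝ) : Matrix (Fin n) (Fin n) ℝ :=
  Matrix.of fun a b => L (w * (X a * X b))

theorem map_mul_quadPoly (L : MvPolynomial (Fin n) ℝ →ₗ[ℝ] ℝ) (w : MvPolynomial (Fin n) ℝ)
    (F : Matrix (Fin n) (Fin n) ℝ) :
    L (w * quadPoly n F) = (F * momentMatrix L w).trace := by
  simp only [quadPoly_apply, Finset.mul_sum, map_sum, Matrix.trace, Matrix.diag_apply,
    Matrix.mul_apply, mul_smul_comm, map_smul, smul_eq_mul, momentMatrix, Matrix.of_apply]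
  refine Finset.sum_congr rfl fun a _ => Finset.sum_congr rfl fun b _ => ?_
  rw [mul_comm (X a)]

section

variable {d j : ℕ} {L : MvPolynomial (Fin n) ℝ →ₗ[ℝ] ℝ} {w : MvPolynomial (Fin n) ℝ}

theorem IsSpherical.map_mul_normSq (hL : IsSpherical d L) {q : MvPolynomial (Fin n) ℝ} {k : ℕ}
    (hq : q.totalDegree ≤ k) (hk : 2 * k ≤ d) : L (q * normSqPoly n) = L q :=
  hL.mul_normSq q (by omega)

theorem IsSpherical.posSemidef_momentMatrix (hL : IsSpherical d L) (hw : w ∈ sosCone n j)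
    (hj : 2 * j + 2 ≤ d) : (momentMatrix L w).PosSemidef := by
  refine Matrix.PosSemidef.of_dotProduct_mulVec_nonneg ?_ fun x => ?_
  · ext a b
    simp only [Matrix.conjTranspose_apply, momentMatrix, Matrix.of_apply, star_trivial,
      mul_comm (X a)]
  · have h1 : (Matrix.vecMulVec x x).PosSemidef := by
      simpa using Matrix.posSemidef_vecMulVec_self_star x
    have h2 := hL.nonneg (by omega) (mul_mem_sosCone hw h1.quadPoly_mem_sosCone)
    rw [map_mul_quadPoly, Matrix.trace_mul_comm, Matrix.mul_vecMulVec,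
      Matrix.trace_vecMulVec, dotProduct_comm] at h2
    simpa using h2

theorem IsSpherical.trace_momentMatrix (hL : IsSpherical d L) (hw : w ∈ sosCone n j)
    (hj : 4 * j ≤ d) : (momentMatrix L w).trace = L w := by
  rw [← hL.map_mul_normSq (totalDegree_le_of_mem_sosCone hw) (by omega), ← quadPoly_one,
    map_mul_quadPoly, Matrix.one_mul]

/-- The largest eigenvalue of `S`, estimated by a trace of powers, bounds the form of `S`. -/
theorem IsSpherical.map_mul_quadPoly_le (hL : IsSpherical d L) (hw : w ∈ sosCone n j)
    (hj : 4 * j + 2 ≤ d) {S : Matrix (Fin n) (Fin n) ℝ} (hS : S.IsHermitian) {R : ℝ} (hR : 0 < R)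
    {q : ℕ} (hq : 1 ≤ q) :
    L (w * quadPoly n S) ≤ L w * (R + R * ((S ^ (2 * q)).trace / R ^ (2 * q))) := by
  have h1 := Matrix.posSemidef_smul_one_sub hS hR hq
  set τ := R + R * ((S ^ (2 * q)).trace / R ^ (2 * q))
  have h2 := hL.nonneg (by omega) (mul_mem_sosCone hw h1.quadPoly_mem_sosCone)
  rw [map_sub, map_smul, quadPoly_one, mul_sub, map_sub, mul_smul_comm, map_smul, smul_eq_mul,
    hL.map_mul_normSq (totalDegree_le_of_mem_sosCone hw) (by omega)] at h2
  linarith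

variable {κ : Type*} [Fintype κ] {A B : κ → Matrix (Fin n) (Fin n) ℝ}

theorem IsSpherical.map_mul_sum_le (hL : IsSpherical d L) (hw : w ∈ sosCone n j)
    (hj : 4 * j + 4 ≤ d) (hA1 : ∀ i, (1 - A i).PosSemidef) (hB : ∀ i, (B i).PosSemidef)
    (hB1 : ∑ i, B i = 1) : L (w * ∑ i, quadPoly n (A i) * quadPoly n (B i)) ≤ L w := by
  have hdeg := totalDegree_le_of_mem_sosCone hw
  have h1 : ∀ i, 0 ≤ L (w * (quadPoly n (1 - A i) * quadPoly n (B i))) := fun i =>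
    hL.nonneg (k := j + (1 + 1)) (by omega) (mul_mem_sosCone hw
      (mul_mem_sosCone (hA1 i).quadPoly_mem_sosCone (hB i).quadPoly_mem_sosCone))
  have h2 : ∑ i, w * (quadPoly n (1 - A i) * quadPoly n (B i)) =
      w * normSqPoly n * normSqPoly n - w * ∑ i, quadPoly n (A i) * quadPoly n (B i) := by
    simp only [map_sub, quadPoly_one, sub_mul, mul_sub, Finset.sum_sub_distrib]
    rw [← Finset.mul_sum, ← Finset.mul_sum, ← Finset.mul_sum, ← map_sum, hB1, quadPoly_one,
      mul_assoc]
  have h3 := Finset.sum_nonneg fun i (_ : i ∈ Finset.univ) => h1 i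
  have hN : (normSqPoly n).totalDegree ≤ 2 := by
    rw [← quadPoly_one]; exact totalDegree_quadPoly_le 1
  rw [← map_sum, h2, map_sub, hL.map_mul_normSq (k := 2 * j + 2)
    ((totalDegree_mul _ _).trans (add_le_add hdeg hN)) (by omega),
    hL.map_mul_normSq hdeg (by omega)] at h3
  linarith

theorem Matrix.posSemidef_one_sub_mul_self {ι : Type*} [Fintype ι] [DecidableEq ι]
    {D : Matrix ι ι ℝ} (h1 : (1 - D).PosSemidef) (h2 : (1 + D).PosSemidef) :
    (1 - D * D).PosSemidef := by
  have h3 := h2.conjTranspose_mul_mul_same (1 - D)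
  have h4 := h1.conjTranspose_mul_mul_same (1 + D)
  rw [h1.isHermitian.eq] at h3
  rw [h2.isHermitian.eq] at h4
  have e : 1 - D * D = (1 / 2 : ℝ) •
      ((1 - D) * (1 + D) * (1 - D) + (1 + D) * (1 - D) * (1 + D)) := by
    have : (1 - D) * (1 + D) * (1 - D) + (1 + D) * (1 - D) * (1 + D) = (2 : ℝ) • (1 - D * D) := by
      rw [two_smul]; noncomm_ring
    rw [this, smul_smul]; norm_num
  rw [e]
  exact (h3.add h4).smul (by norm_num)

/-- After reweighing by `w`, replacing the matrices `A i` by their mean under the outcome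
probabilities `L (w B i) / L w` leaves the value of a product state. -/
theorem IsSpherical.map_mul_sum_le_of_mean (hL : IsSpherical d L) (hw : w ∈ sosCone n j)
    (hj : 4 * j + 4 ≤ d) (hB1 : ∑ i, B i = 1) {V : ℝ}
    (hV : ∀ ρ : Matrix (Fin n) (Fin n) ℝ, ρ.PosSemidef → ρ.trace = 1 →
      ∑ i, (A i * ρ).trace * (B i * ρ).trace ≤ V)
    (hc : 0 < L w) {Ā : Matrix (Fin n) (Fin n) ℝ}
    (hĀ : Ā = ∑ i, (L (w * quadPoly n (B i)) / L w) • A i) :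
    L (w * ∑ i, quadPoly n (A i) * quadPoly n (B i)) ≤
      L w * V + ∑ i, L (w * quadPoly n (B i) * quadPoly n (A i - Ā)) := by
  have hdeg := totalDegree_le_of_mem_sosCone hw
  have h1 : ∑ i, L (w * quadPoly n (B i) * quadPoly n (A i - Ā)) =
      L (w * ∑ i, quadPoly n (A i) * quadPoly n (B i)) - L (w * quadPoly n Ā) := by
    have h2 : ∑ i, w * quadPoly n (B i) * quadPoly n (A i - Ā) =
        w * ∑ i, quadPoly n (A i) * quadPoly n (B i) - w * quadPoly n Ā * normSqPoly n := by
      rw [← quadPoly_one, ← hB1, map_sum, Finset.mul_sum, Finset.mul_sum,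
        ← Finset.sum_sub_distrib]
      refine Finset.sum_congr rfl fun i _ => ?_
      rw [map_sub]; ring
    rw [← map_sum, h2, map_sub, hL.map_mul_normSq (k := 2 * j + 2)
      ((totalDegree_mul _ _).trans (add_le_add hdeg (totalDegree_quadPoly_le _))) (by omega)]
  have h3 : L (w * quadPoly n Ā) ≤ L w * V := by
    set ρ := (L w)⁻¹ • momentMatrix L w with hρ
    have hρ1 : ρ.PosSemidef :=
      (hL.posSemidef_momentMatrix hw (by omega)).smul (inv_nonneg.2 hc.le)
    have hρ2 : ρ.trace = 1 := by
      rw [hρ, Matrix.trace_smul, hL.trace_momentMatrix hw (by omega), smul_eq_mul,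
        inv_mul_cancel₀ hc.ne']
    have hρ3 : ∀ F, (F * ρ).trace = L (w * quadPoly n F) / L w := fun F => by
      rw [hρ, Matrix.mul_smul, Matrix.trace_smul, map_mul_quadPoly, smul_eq_mul, div_eq_inv_mul]
    have h4 := hV ρ hρ1 hρ2
    have h5 : L (w * quadPoly n Ā) = L w * ∑ i, (A i * ρ).trace * (B i * ρ).trace := by
      simp only [hρ3]
      rw [hĀ, map_sum, Finset.mul_sum, map_sum, Finset.mul_sum]
      refine Finset.sum_congr rfl fun i _ => ?_
      rw [map_smul, mul_smul_comm, map_smul, smul_eq_mul]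
      field_simp
    rw [h5]
    exact mul_le_mul_of_nonneg_left h4 hc.le
  linarith

/-- The estimate after `r` more rounds of conditioning. The weight `w` is the product of the
outcomes `B i` seen so far and `S` is the sum of the martingale differences `A i - Ā`. -/
theorem IsSpherical.nsmul_map_mul_add_le (hL : IsSpherical d L)
    (hA : ∀ i, (A i).PosSemidef) (hA1 : ∀ i, (1 - A i).PosSemidef)
    (hB : ∀ i, (B i).PosSemidef) (hB1 : ∑ i, B i = 1) {V : ℝ}
    (hV : ∀ ρ : Matrix (Fin n) (Fin n) ℝ, ρ.PosSemidef → ρ.trace = 1 →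
      ∑ i, (A i * ρ).trace * (B i * ρ).trace ≤ V)
    {R T : ℝ} (hR : 0 < R) (hT : 0 < T) {q : ℕ} (hq : 1 ≤ q) (r : ℕ) :
    ∀ (j : ℕ) (w : MvPolynomial (Fin n) ℝ) (S : Matrix (Fin n) (Fin n) ℝ), w ∈ sosCone n j →
      4 * (j + r) + 4 ≤ d → S.IsHermitian →
      r * L (w * ∑ i, quadPoly n (A i) * quadPoly n (B i)) + L (w * quadPoly n S) ≤
        L w * (r * V + R + R / R ^ (2 * q) * (Real.exp (4 * q ^ 2 / T ^ 2) ^ r *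
          ((S ^ (2 * q)).trace + n * T ^ (2 * q)))) := by
  set β := Real.exp (4 * q ^ 2 / T ^ 2) with hβ
  have hβ1 : 1 ≤ β := Real.one_le_exp (by positivity)
  -- the eigenvalue bound with the potential in place of the trace
  have hbase : ∀ (s j : ℕ) (w : MvPolynomial (Fin n) ℝ) (S : Matrix (Fin n) (Fin n) ℝ),
      w ∈ sosCone n j → 4 * j + 4 ≤ d → S.IsHermitian →
      L (w * quadPoly n S) ≤ L w * (R + R / R ^ (2 * q) * (β ^ s *
          ((S ^ (2 * q)).trace + n * T ^ (2 * q)))) := by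
    intro s j w S hw hj hS
    refine (hL.map_mul_quadPoly_le hw (by omega) hS hR hq).trans ?_
    refine mul_le_mul_of_nonneg_left ?_ (hL.nonneg (by omega) hw)
    have h0 := Matrix.trace_pow_nonneg hS q
    have h1 : (S ^ (2 * q)).trace ≤ β ^ s * ((S ^ (2 * q)).trace + n * T ^ (2 * q)) := by
      have h2 : (S ^ (2 * q)).trace ≤ (S ^ (2 * q)).trace + n * T ^ (2 * q) := by
        have : (0 : ℝ) ≤ n * T ^ (2 * q) := by positivity
        linarith
      exact h2.trans (le_mul_of_one_le_left (h0.trans h2) (one_le_pow₀ hβ1))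
    have h3 : R * ((S ^ (2 * q)).trace / R ^ (2 * q)) = R / R ^ (2 * q) * (S ^ (2 * q)).trace := by
      ring
    rw [h3]
    gcongr
  induction r with
  | zero =>
    intro j w S hw hj hS
    have := hbase 0 j w S hw (by omega) hS
    simpa using this
  | succ r ih =>
    intro j w S hw hj hS
    have hdeg := totalDegree_le_of_mem_sosCone hw
    set P := ∑ i, quadPoly n (A i) * quadPoly n (B i) with hP
    rcases (hL.nonneg (by omega) hw : 0 ≤ L w).eq_or_lt with hc | hc
    · have h1 := hL.map_mul_sum_le hw (by omega) hA1 hB hB1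
      have h2 := hbase 0 j w S hw (by omega) hS
      rw [← hP] at h1
      rw [← hc] at h1 h2 ⊢
      rw [zero_mul] at h2 ⊢
      have h3 : ((r + 1 : ℕ) : ℝ) * L (w * P) ≤ 0 :=
        mul_nonpos_of_nonneg_of_nonpos (by positivity) h1
      linarith
    set p : κ → ℝ := fun i => L (w * quadPoly n (B i)) / L w with hp
    set Ā := ∑ i, p i • A i with hĀ
    have hwB : ∀ i, w * quadPoly n (B i) ∈ sosCone n (j + 1) := fun i =>
      mul_mem_sosCone hw (hB i).quadPoly_mem_sosCone
    have hLp : ∀ i, L (w * quadPoly n (B i)) = L w * p i := fun i => by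
      rw [hp]; field_simp
    have hp0 : ∀ i, 0 ≤ p i := fun i => div_nonneg (hL.nonneg (by omega) (hwB i)) hc.le
    -- the forms `B i` sum to `‖X‖ ^ 2`, so a factor `B i` may be split off
    have hsplit : ∀ f : MvPolynomial (Fin n) ℝ, f.totalDegree ≤ 4 →
        L (w * f) = ∑ i, L (w * quadPoly n (B i) * f) := fun f hf => by
      rw [← hL.map_mul_normSq (k := 2 * j + 4)
        ((totalDegree_mul w f).trans (add_le_add hdeg hf)) (by omega), ← quadPoly_one, ← hB1,
        map_sum, Finset.mul_sum, map_sum]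
      refine Finset.sum_congr rfl fun i _ => ?_
      congr 1; ring
    have hp1 : ∑ i, p i = 1 := by
      have := hsplit 1 (by simp)
      simp only [mul_one, hLp, ← Finset.mul_sum] at this
      exact mul_left_cancel₀ hc.ne' (by linarith)
    have hmean : ∀ i, (1 - (A i - Ā)).PosSemidef ∧ (1 + (A i - Ā)).PosSemidef := fun i => by
      have h1 : Ā.PosSemidef := Matrix.posSemidef_sum _ fun i _ => (hA i).smul (hp0 i)
      have h2 : (1 - Ā).PosSemidef := by
        have : 1 - Ā = ∑ i, p i • (1 - A i) := by
          simp only [smul_sub, Finset.sum_sub_distrib, ← Finset.sum_smul, hp1, one_smul, hĀ]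
        rw [this]
        exact Matrix.posSemidef_sum _ fun i _ => (hA1 i).smul (hp0 i)
      constructor
      · have : 1 - (A i - Ā) = (1 - A i) + Ā := by abel
        rw [this]; exact (hA1 i).add h1
      · have : 1 + (A i - Ā) = A i + (1 - Ā) := by abel
        rw [this]; exact (hA i).add h2
    have hD : ∀ i, (A i - Ā).IsHermitian := fun i =>
      (hA i).isHermitian.sub
        (Matrix.posSemidef_sum _ fun i _ => (hA i).smul (hp0 i)).isHermitian
    have hD0 : ∑ i, p i • (A i - Ā) = 0 := by
      simp only [smul_sub, Finset.sum_sub_distrib, ← Finset.sum_smul, hp1, one_smul, ← hĀ,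
        sub_self]
    have hpot := Matrix.sum_trace_add_pow_le hp0 hp1 hD
      (fun i => Matrix.posSemidef_one_sub_mul_self (hmean i).1 (hmean i).2) hD0 hS hq hT
    rw [← hβ, Fintype.card_fin] at hpot
    have hround := hL.map_mul_sum_le_of_mean hw (by omega) hB1 hV hc hĀ
    rw [← hP] at hround
    have hPdeg : P.totalDegree ≤ 4 := by
      rw [hP]
      refine totalDegree_finsetSum_le fun i _ => (totalDegree_mul _ _).trans ?_
      have h1 := totalDegree_quadPoly_le (A i)
      have h2 := totalDegree_quadPoly_le (B i)
      omega
    have hnext := Finset.sum_le_sum fun i (_ : i ∈ Finset.univ) =>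
      ih (j + 1) _ (S + (A i - Ā)) (hwB i) (by omega) (hS.add (hD i))
    simp only [map_add (quadPoly n) S, mul_add (_ * quadPoly n _) (quadPoly n S), map_add L,
      Finset.sum_add_distrib, ← Finset.mul_sum] at hnext
    rw [← hsplit P hPdeg, ← hsplit (quadPoly n S) ((totalDegree_quadPoly_le S).trans (by omega))]
      at hnext
    have hlast : ∑ i, L (w * quadPoly n (B i)) * (r * V + R + R / R ^ (2 * q) * (β ^ r *
          (((S + (A i - Ā)) ^ (2 * q)).trace + n * T ^ (2 * q)))) ≤
        L w * (r * V + R + R / R ^ (2 * q) * (β ^ (r + 1) *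
          ((S ^ (2 * q)).trace + n * T ^ (2 * q)))) := by
      have e : ∑ i, L (w * quadPoly n (B i)) * (r * V + R + R / R ^ (2 * q) * (β ^ r *
          (((S + (A i - Ā)) ^ (2 * q)).trace + n * T ^ (2 * q)))) =
          L w * ((r * V + R) * ∑ i, p i + R / R ^ (2 * q) * (β ^ r *
            ∑ i, p i * (((S + (A i - Ā)) ^ (2 * q)).trace + n * T ^ (2 * q)))) := by
        rw [Finset.mul_sum, Finset.mul_sum, Finset.mul_sum, ← Finset.sum_add_distrib,
          Finset.mul_sum]
        refine Finset.sum_congr rfl fun i _ => ?_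
        rw [hLp]; ring
      rw [e, hp1, mul_one, pow_succ, mul_assoc (β ^ r)]
      gcongr
    push_cast
    linarith

end

/-! ### Choice of the parameters -/

/-- The estimate after `k` rounds, with the parameters of the potential chosen: `q` is about
`log n`, so that `n` is absorbed by `exp q`. -/
theorem IsSpherical.map_sum_le_add_sqrt {d : ℕ} {L : MvPolynomial (Fin n) ℝ →ₗ[ℝ] ℝ}
    (hL : IsSpherical d L) {κ : Type*} [Fintype κ] {A B : κ → Matrix (Fin n) (Fin n) ℝ}
    (hA : ∀ i, (A i).PosSemidef) (hA1 : ∀ i, (1 - A i).PosSemidef)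
    (hB : ∀ i, (B i).PosSemidef) (hB1 : ∑ i, B i = 1) {V : ℝ}
    (hV : ∀ ρ : Matrix (Fin n) (Fin n) ℝ, ρ.PosSemidef → ρ.trace = 1 →
      ∑ i, (A i * ρ).trace * (B i * ρ).trace ≤ V)
    {q k : ℕ} (hq : 1 ≤ q) (hnq : (n : ℝ) ≤ Real.exp q) (hk : 1 ≤ k) (hkd : 4 * k + 4 ≤ d) :
    L (∑ i, quadPoly n (A i) * quadPoly n (B i)) ≤ V + 4 * Real.exp 1 * Real.sqrt (q / k) := by
  have hq0 : (0 : ℝ) < q := by exact_mod_cast hq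
  have hk0 : (0 : ℝ) < k := by exact_mod_cast hk
  -- with `T² = 4 q k` the potential grows by `exp q` over `k` rounds
  set T := Real.sqrt (4 * q * k) with hT
  have hT0 : 0 < T := Real.sqrt_pos.2 (by positivity)
  have hT2 : T ^ 2 = 4 * q * k := Real.sq_sqrt (by positivity)
  set R := Real.exp 1 * T with hR
  have hR0 : 0 < R := by positivity
  have key := hL.nsmul_map_mul_add_le hA hA1 hB hB1 hV hR0 hT0 hq k 0 1 0 (one_mem_sosCone 0)
    (by omega) Matrix.isHermitian_zero
  have hz : ((0 : Matrix (Fin n) (Fin n) ℝ) ^ (2 * q)).trace = 0 := by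
    rw [zero_pow (by omega), Matrix.trace_zero]
  rw [hz, zero_add, map_zero, mul_zero, map_zero, add_zero, one_mul, hL.map_one, one_mul] at key
  have hβ : Real.exp (4 * q ^ 2 / T ^ 2) ^ k = Real.exp q := by
    rw [← Real.exp_nat_mul, hT2]
    congr 1
    field_simp
  have hRT : R ^ (2 * q) = Real.exp q * Real.exp q * T ^ (2 * q) := by
    rw [hR, mul_pow, ← Real.exp_nat_mul, ← Real.exp_add]
    congr 2
    push_cast; ring
  have hpot : R / R ^ (2 * q) * (Real.exp (4 * q ^ 2 / T ^ 2) ^ k * (n * T ^ (2 * q))) ≤ R := by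
    rw [hβ, hRT, div_mul_eq_mul_div, div_le_iff₀ (by positivity)]
    have : Real.exp q * (n * T ^ (2 * q)) ≤ Real.exp q * (Real.exp q * T ^ (2 * q)) := by gcongr
    calc _ ≤ R * (Real.exp q * (Real.exp q * T ^ (2 * q))) := by gcongr
      _ = _ := by ring
  have hTk : T = 2 * k * Real.sqrt (q / k) := by
    rw [hT, Real.sqrt_eq_iff_mul_self_eq (by positivity) (by positivity)]
    have := Real.mul_self_sqrt (show (0 : ℝ) ≤ q / k by positivity)
    calc 4 * q * k = 4 * k ^ 2 * (Real.sqrt (q / k) * Real.sqrt (q / k)) := by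
          rw [this]; field_simp
      _ = 2 * k * Real.sqrt (q / k) * (2 * k * Real.sqrt (q / k)) := by ring
  have h2R : 2 * R = k * (4 * Real.exp 1 * Real.sqrt (q / k)) := by
    rw [hR, hTk]; ring
  refine le_of_mul_le_mul_left ?_ hk0
  linarith

/-- In one variable every pseudo-expectation of `P` is a value of `P`. -/
theorem IsSpherical.map_sum_eq_of_fin_one {d : ℕ} {L : MvPolynomial (Fin 1) ℝ →ₗ[ℝ] ℝ}
    (hL : IsSpherical d L) (hd : 4 ≤ d) {κ : Type*} [Fintype κ]
    (F G : κ → Matrix (Fin 1) (Fin 1) ℝ) :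
    L (∑ i, quadPoly 1 (F i) * quadPoly 1 (G i)) =
      ∑ i, ((1 : Fin 1 → ℝ) ⬝ᵥ (F i).mulVec 1) * ((1 : Fin 1 → ℝ) ⬝ᵥ (G i).mulVec 1) := by
  have hq : ∀ H : Matrix (Fin 1) (Fin 1) ℝ, quadPoly 1 H = H 0 0 • normSqPoly 1 := fun H => by
    rw [quadPoly_apply, normSqPoly]; simp [sq]
  have hN : (normSqPoly 1).totalDegree ≤ 2 := by
    rw [← quadPoly_one]; exact totalDegree_quadPoly_le 1
  have hNN : L (normSqPoly 1 * normSqPoly 1) = 1 := by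
    have h1 := hL.mul_normSq 1 (by simp)
    rw [one_mul, hL.map_one] at h1
    rw [hL.map_mul_normSq hN (by omega), h1]
  rw [map_sum]
  refine Finset.sum_congr rfl fun i _ => ?_
  rw [hq, hq, smul_mul_smul_comm, map_smul, hNN]
  simp [dotProduct, Matrix.mulVec]

/-- The error term is at most `ε` once `d ≥ 2400 log n / ε²`; below degree `16` this forces
`ε ≥ 1`, where the trivial bound `1` suffices. -/
theorem IsSpherical.map_sum_le_add {d : ℕ} {L : MvPolynomial (Fin n) ℝ →ₗ[ℝ] ℝ}
    (hL : IsSpherical d L) (hd : 4 ≤ d) {κ : Type*} [Fintype κ]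
    {A B : κ → Matrix (Fin n) (Fin n) ℝ}
    (hA : ∀ i, (A i).PosSemidef) (hA1 : ∀ i, (1 - A i).PosSemidef)
    (hB : ∀ i, (B i).PosSemidef) (hB1 : ∑ i, B i = 1) {V : ℝ} (hV0 : 0 ≤ V)
    (hV : ∀ ρ : Matrix (Fin n) (Fin n) ℝ, ρ.PosSemidef → ρ.trace = 1 →
      ∑ i, (A i * ρ).trace * (B i * ρ).trace ≤ V)
    (hn : 2 ≤ n) {ε : ℝ} (hε : 0 < ε) (hdε : 2400 / ε ^ 2 * Real.log n ≤ d) :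
    L (∑ i, quadPoly n (A i) * quadPoly n (B i)) ≤ V + ε := by
  have hlog2 : 0.6931471803 < Real.log 2 := Real.log_two_gt_d9
  have hlog : Real.log 2 ≤ Real.log n := Real.log_le_log (by norm_num) (by exact_mod_cast hn)
  have hdε' : 2400 * Real.log n ≤ d * ε ^ 2 := by
    rwa [div_mul_eq_mul_div, div_le_iff₀ (by positivity)] at hdε
  by_cases hd16 : d < 16
  · have h1 := hL.map_mul_sum_le (one_mem_sosCone 0) (by omega) hA1 hB hB1
    rw [one_mul, hL.map_one] at h1
    have h2 : (d : ℝ) ≤ 16 := by exact_mod_cast hd16.le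
    have h3 : 1 ≤ ε ^ 2 := by nlinarith [_root_.sq_nonneg ε]
    have h4 : 1 ≤ ε := by nlinarith
    linarith
  · push Not at hd16
    set q := ⌈Real.log n⌉₊ with hq
    set k := d / 4 - 1 with hk
    have hq1 : 1 ≤ q := Nat.one_le_ceil_iff.2 (by linarith)
    have hnq : (n : ℝ) ≤ Real.exp q := by
      rw [← Real.log_le_iff_le_exp (by positivity)]
      exact Nat.le_ceil _
    refine (hL.map_sum_le_add_sqrt hA hA1 hB hB1 hV hq1 hnq (k := k) (by omega) (by omega)).trans ?_
    gcongr
    have hql : (q : ℝ) ≤ 5 / 2 * Real.log n := by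
      have := (Nat.ceil_lt_add_one (show 0 ≤ Real.log n by linarith)).le
      rw [← hq] at this
      linarith
    have hkd : (d : ℝ) / 8 ≤ k := by
      have : d ≤ 8 * k := by omega
      have : (d : ℝ) ≤ 8 * k := by exact_mod_cast this
      linarith
    have hd0 : (0 : ℝ) < d := by positivity
    have hqk : (q : ℝ) / k ≤ ε ^ 2 / 120 := by
      rw [div_le_iff₀ (by linarith)]
      nlinarith [_root_.sq_nonneg ε]
    have he : Real.exp 1 < 2.7182818286 := Real.exp_one_lt_d9
    have he0 := Real.exp_pos 1
    have hsq : (4 * Real.exp 1 * Real.sqrt (q / k)) ^ 2 ≤ ε ^ 2 := by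
      rw [mul_pow, Real.sq_sqrt (by positivity)]
      have h5 : (4 * Real.exp 1) ^ 2 ≤ 120 := by nlinarith
      calc (4 * Real.exp 1) ^ 2 * (q / k) ≤ 120 * (ε ^ 2 / 120) := by gcongr
        _ = ε ^ 2 := by ring
    exact le_of_sq_le_sq hsq hε.le

/-! ### One-way local measurement polynomials -/

theorem IsOneWayLOCC.exists_matrices {m : ℕ} {P : MvPolynomial (Fin n) ℝ}
    {A B : Fin m → MvPolynomial (Fin n) ℝ} (h : IsOneWayLOCC P A B) :
    ∃ F G : Fin m → Matrix (Fin n) (Fin n) ℝ, (∀ i, quadPoly n (F i) = A i) ∧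
      (∀ i, quadPoly n (G i) = B i) ∧ (∀ i, (F i).PosSemidef) ∧ (∀ i, (1 - F i).PosSemidef) ∧
      (∀ i, (G i).PosSemidef) ∧ (1 - ∑ i, G i).PosSemidef := by
  choose F hF hFA using fun i => (h.homogeneous_A i).exists_quadPoly_eq
  choose G hG hGB using fun i => (h.homogeneous_B i).exists_quadPoly_eq
  refine ⟨F, G, hFA, hGB, fun i => ?_, fun i => ?_, fun i => ?_, ?_⟩
  · refine Matrix.posSemidef_of_eval_quadPoly_nonneg (hF i) fun x => ?_
    have := IsSumSq.eval_nonneg (h.nonneg_A i) x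
    rwa [sub_zero, ← hFA] at this
  · refine Matrix.posSemidef_of_eval_quadPoly_nonneg (Matrix.isHermitian_one.sub (hF i)) fun x => ?_
    have := IsSumSq.eval_nonneg (h.A_le i) x
    rwa [← hFA, ← quadPoly_one, ← map_sub] at this
  · refine Matrix.posSemidef_of_eval_quadPoly_nonneg (hG i) fun x => ?_
    have := IsSumSq.eval_nonneg (h.nonneg_B i) x
    rwa [sub_zero, ← hGB] at this
  · refine Matrix.posSemidef_of_eval_quadPoly_nonneg (Matrix.isHermitian_one.sub ?_) fun x => ?_
    · rw [Matrix.IsHermitian, Matrix.conjTranspose_sum]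
      exact Finset.sum_congr rfl fun i _ => hG i
    · have := IsSumSq.eval_nonneg h.sum_B_le x
      simp only [← hGB] at this
      rwa [← map_sum, ← quadPoly_one, ← map_sub] at this

theorem polyNorm_nonneg (P : MvPolynomial (Fin n) ℝ) : 0 ≤ polyNorm P :=
  Real.sSup_nonneg (by rintro r ⟨x, -, rfl⟩; exact abs_nonneg _)

/-- The sphere is compact, so `polyNorm` is a genuine supremum; homogeneity carries the bound from
the sphere to all points. -/
theorem IsOneWayLOCC.sum_mul_le_polyNorm {m : ℕ} {P : MvPolynomial (Fin n) ℝ}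
    {A B : Fin m → MvPolynomial (Fin n) ℝ} (h : IsOneWayLOCC P A B)
    {F G : Fin m → Matrix (Fin n) (Fin n) ℝ} (hFA : ∀ i, quadPoly n (F i) = A i)
    (hGB : ∀ i, quadPoly n (G i) = B i) (x : Fin n → ℝ) :
    ∑ i, (x ⬝ᵥ (F i).mulVec x) * (x ⬝ᵥ (G i).mulVec x) ≤ polyNorm P * (x ⬝ᵥ x) ^ 2 := by
  have heval : ∀ y, eval y P = ∑ i, (y ⬝ᵥ (F i).mulVec y) * (y ⬝ᵥ (G i).mulVec y) := fun y => by
    rw [h.eq_sum, map_sum]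
    exact Finset.sum_congr rfl fun i _ => by
      rw [map_mul, ← hFA, ← hGB, eval_quadPoly, eval_quadPoly]
  have hbdd : BddAbove {r : ℝ | ∃ x : EuclideanSpace ℝ (Fin n), ‖x‖ = 1 ∧
      r = |eval (fun i => x i) P|} := by
    have hcont : Continuous fun x : EuclideanSpace ℝ (Fin n) => |eval (fun i => x i) P| :=
      ((MvPolynomial.continuous_eval P).comp (PiLp.continuous_ofLp 2 _)).abs
    refine ((isCompact_sphere (0 : EuclideanSpace ℝ (Fin n)) 1).image hcont).bddAbove.mono ?_
    rintro r ⟨x, hx, rfl⟩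
    exact ⟨x, by simpa using hx, rfl⟩
  by_cases hx : x = 0
  · simp [hx]
  have hs : 0 < x ⬝ᵥ x := by
    have := Matrix.dotProduct_star_self_pos_iff (v := x)
    rw [star_trivial] at this
    exact this.2 hx
  set s := Real.sqrt (x ⬝ᵥ x) with hsdef
  have hs0 : 0 < s := Real.sqrt_pos.2 hs
  have hs2 : s ^ 2 = x ⬝ᵥ x := Real.sq_sqrt hs.le
  have hy1 : ‖WithLp.toLp 2 (s⁻¹ • x)‖ = 1 := by
    rw [EuclideanSpace.norm_eq]
    simp only [Pi.smul_apply, smul_eq_mul, Real.norm_eq_abs, sq_abs, mul_pow]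
    rw [← Finset.mul_sum]
    have : ∑ i, x i ^ 2 = s ^ 2 := by
      rw [hs2]; exact Finset.sum_congr rfl fun i _ => sq _
    rw [this, ← mul_pow, inv_mul_cancel₀ hs0.ne']
    simp
  have hle : eval (s⁻¹ • x) P ≤ polyNorm P :=
    (le_abs_self _).trans (le_csSup hbdd ⟨WithLp.toLp 2 (s⁻¹ • x), hy1, rfl⟩)
  have hscale : eval (s⁻¹ • x) P * (x ⬝ᵥ x) ^ 2 =
      ∑ i, (x ⬝ᵥ (F i).mulVec x) * (x ⬝ᵥ (G i).mulVec x) := by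
    rw [heval, ← hs2, Finset.sum_mul]
    refine Finset.sum_congr rfl fun i _ => ?_
    simp only [Matrix.mulVec_smul, smul_dotProduct, dotProduct_smul, smul_eq_mul]
    field_simp
  rw [← hscale]
  gcongr

/-- A bound `V` on the values of `P` at product states bounds its pseudo-expectations up to `ε`.
For `n = 1` the hypothesis on `d` is void, and `polyNorm P ≤ V` is used instead. -/
theorem IsOneWayLOCC.map_le_add {m d : ℕ} {P : MvPolynomial (Fin n) ℝ}
    {A B : Fin m → MvPolynomial (Fin n) ℝ} (h : IsOneWayLOCC P A B)
    {F G : Fin m → Matrix (Fin n) (Fin n) ℝ} (hFA : ∀ i, quadPoly n (F i) = A i)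
    (hGB : ∀ i, quadPoly n (G i) = B i) (hF : ∀ i, (F i).PosSemidef)
    (hF1 : ∀ i, (1 - F i).PosSemidef) (hG : ∀ i, (G i).PosSemidef)
    (hG1 : (1 - ∑ i, G i).PosSemidef) {L : MvPolynomial (Fin n) ℝ →ₗ[ℝ] ℝ}
    (hL : IsSpherical d L) (hd : 4 ≤ d) {V : ℝ} (hPV : polyNorm P ≤ V)
    (hV : ∀ ρ : Matrix (Fin n) (Fin n) ℝ, ρ.PosSemidef → ρ.trace = 1 →
      ∑ i, (F i * ρ).trace * (G i * ρ).trace ≤ V)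
    {ε : ℝ} (hε : 0 < ε) (hdε : 2400 / ε ^ 2 * Real.log n ≤ d) : L P ≤ V + ε := by
  have hP : P = ∑ i, quadPoly n (F i) * quadPoly n (G i) := by
    simp only [h.eq_sum, hFA, hGB]
  rcases lt_trichotomy n 1 with hn | rfl | hn
  · -- without variables the sphere is empty, and no functional is consistent with it
    obtain rfl : n = 0 := by omega
    have h1 := hL.mul_normSq 1 (by simp)
    rw [hL.map_one] at h1
    simp [normSqPoly] at h1
  · have h1 := h.sum_mul_le_polyNorm hFA hGB 1
    rw [← hL.map_sum_eq_of_fin_one hd, ← hP] at h1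
    simp only [dotProduct, Pi.one_apply, mul_one, Finset.univ_unique, Finset.sum_const,
      Finset.card_singleton, one_smul, one_pow] at h1
    linarith
  · -- an additional outcome with `A = 0` makes the forms `B` sum to `‖X‖ ^ 2`
    let F' : Option (Fin m) → Matrix (Fin n) (Fin n) ℝ := fun o => o.elim 0 F
    let G' : Option (Fin m) → Matrix (Fin n) (Fin n) ℝ := fun o => o.elim (1 - ∑ i, G i) G
    have hP' : P = ∑ o, quadPoly n (F' o) * quadPoly n (G' o) := by
      rw [hP, Fintype.sum_option]
      simp [F', G']
    rw [hP']
    refine hL.map_sum_le_add hd (A := F') (B := G') ?_ ?_ ?_ ?_ ((polyNorm_nonneg P).trans hPV) ?_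
      hn hε hdε
    · rintro (_ | i)
      · exact Matrix.PosSemidef.zero
      · exact hF i
    · rintro (_ | i)
      · simpa [F'] using Matrix.PosSemidef.one
      · exact hF1 i
    · rintro (_ | i)
      · exact hG1
      · exact hG i
    · rw [Fintype.sum_option]
      simp [G']
    · intro ρ hρ htr
      rw [Fintype.sum_option]
      simpa [F', G'] using hV ρ hρ htr

theorem MvPolynomial.eval_congr_of_vars {σ R : Type*} [CommSemiring R] {p : MvPolynomial σ R}
    {x y : σ → R} (h : ∀ a ∈ p.vars, x a = y a) : eval x p = eval y p :=
  eval₂Hom_congr' rfl (fun a ha _ => h a ha) rfl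

theorem sosValue_le {d : ℕ} {P : MvPolynomial (Fin n) ℝ} {hP : P.totalDegree ≤ d} {c : ℝ}
    (h : ∀ L : MvPolynomial (Fin n) ℝ →ₗ[ℝ] ℝ, IsSpherical d L → L P ≤ c) :
    sosValue d P hP ≤ (c : EReal) := by
  refine iSup₂_le fun μ hμ => EReal.coe_le_coe_iff.2 ?_
  obtain ⟨L, hL, hLE⟩ := hμ.exists_isSpherical
  rw [← hLE]
  exact h L hL

end

theorem theoremC1 :
    ∃ C : ℝ, 0 < C ∧
      ∀ (n : ℕ) (ε : ℝ) (_ : 0 < ε) (d : ℕ) (hd : 4 ≤ d)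
        (_ : C / ε ^ 2 * Real.log (n : ℝ) ≤ (d : ℝ))
        (m : ℕ) (P : MvPolynomial (Fin n) ℝ) (A B : Fin m → MvPolynomial (Fin n) ℝ)
        (h : IsOneWayLOCC P A B),
        sosValue d P (h.totalDegree_le.trans hd) ≤ ((3 * polyNorm P + ε : ℝ) : EReal) ∧
        ((∀ i j, Disjoint (A i).vars (B j).vars) →
          sosValue d P (h.totalDegree_le.trans hd) ≤ ((polyNorm P + ε : ℝ) : EReal)) := by
  refine ⟨2400, by norm_num, fun n ε hε d hd hdε m P A B h => ?_⟩
  obtain ⟨F, G, hFA, hGB, hF, hF1, hG, hG1⟩ := h.exists_matrices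
  have hN := h.sum_mul_le_polyNorm hFA hGB
  have hN0 := polyNorm_nonneg P
  refine ⟨sosValue_le fun L hL => ?_, fun hdisj => sosValue_le fun L hL => ?_⟩
  · exact h.map_le_add hFA hGB hF hF1 hG hG1 hL hd (by linarith)
      (fun ρ hρ htr => sum_trace_mul_trace_le hF hG hN0 hN hρ htr) hε hdε
  · refine h.map_le_add hFA hGB hF hF1 hG hG1 hL hd le_rfl
      (fun ρ hρ htr => sum_trace_mul_trace_le_of_disjoint hN0 hN
        (Finset.univ.biUnion fun i => (A i).vars) ?_ ?_ hρ htr) hε hdε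
    · intro i x y hxy
      rw [← eval_quadPoly, ← eval_quadPoly, hFA]
      exact eval_congr_of_vars fun a ha =>
        hxy a (Finset.mem_biUnion.2 ⟨i, Finset.mem_univ i, ha⟩)
    · intro i x y hxy
      rw [← eval_quadPoly, ← eval_quadPoly, hGB]
      refine eval_congr_of_vars fun a ha => hxy a fun hmem => ?_
      obtain ⟨j, -, hj⟩ := Finset.mem_biUnion.1 hmem
      exact Finset.disjoint_left.1 (hdisj j i) hj ha
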